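/- Let $\Gamma$ be a discrete group with reduced group $C^*$-algebra $C^*_r(\Gamma)\subset B(\ell^2\Gamma)$ and coproduct $\delta(\lambda_g)=\lambda_g\otimes\lambda_g$; let $\otimes$ denote the minimal tensor product. A coaction of $C^*_r(\Gamma)$ on a $C^*$-algebra $A$ is an injective $*$-homomorphism $\alpha\colon A\to C^*_r(\Gamma)\otimes A$ such that $(\iota\otimes\alpha)\circ\alpha=(\delta\otimes\iota)\circ\alpha$ and $(C^*_r(\Gamma)\otimes 1)\,\alpha(A)$ has dense linear span in $C^*_r(\Gamma)\otimes A$. Let $\omega\colon\Gamma\times\Gamma\to \mathrm U(1)$ be a normalized 2-cocycle, i.e. $\omega(g,h)\omega(gh,k)=\omega(h,k)\omega(g,hk)$ and $\omega(g,e)=\omega(e,g)=1$. The twisted reduced group algebra $C^*_{r,\omega}(\Gamma)$ is the $C^*$-algebra generated by the operators $\lambda^{(\omega)}_g\delta_h=\omega(g,h)\delta_{gh}$ on $\ell^2(\Gamma)$; it carries the coaction $\delta^{(\omega)}_l(\lambda^{(\omega)}_g)=\lambda_g\otimes\lambda^{(\omega)}_g$ and the homomorphism $\widetilde{\mathrm{Ad}}^{(\omega)}(x)=\sum_h\delta_h\otimes(\lambda_h^{(\omega)})^*x\lambda_h^{(\omega)}$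 into the multipliers of $C_0(\Gamma)\otimes C^*_{r,\omega}(\Gamma)$. The braided tensor product $A\boxtimes C^*_{r,\omega}(\Gamma)$ is the $C^*$-algebra generated by the operators $\alpha(a)_{12}\,\widetilde{\mathrm{Ad}}^{(\omega)}(x)_{13}$ on $\ell^2(\Gamma)\otimes A\otimes\ell^2(\Gamma)$, for $a\in A$ and $x\in C^*_{r,\omega}(\Gamma)$; the diagonal coaction on it sends such a generator to $\big((\delta\otimes\iota)\alpha(a)\big)_{123}\,\big((\iota\otimes\widetilde{\mathrm{Ad}}^{(\omega)})\delta^{(\omega)}_l(x)\big)_{124}$. The deformed algebra $A_\omega$ is the fixed point algebra, under the diagonal coaction, of $A\boxtimes C^*_{r,\overline\omega}(\Gamma)$, where $\overline\omega$ is the complex conjugate cocycle. Then: 1. for every $C^*$-algebra $A$ with a coaction $\alpha$ of $C^*_r(\Gamma)$, if $\omega$ is the trivial cocycle (constantly $1$), then $A_\omega$ is isomorphic to $A$ as a $C^*$-algebra; 2. for every normalized $\mathrm U(1)$-valued 2-cocycle $\omega$ on $\Gamma$, if $(A,\alpha)=(C^*_r(\Gamma),\delta)$, then $A_\omega$ is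 isomorphic to $C^*_{r,\omega}(\Gamma)$ as a $C^*$-algebra. -/

import Mathlib

open scoped ComplexOrder

universe u v w

namespace CocycleDeformation

noncomputable section

/-- The Hilbert space `ℓ²(X)`. Throughout, `ℓ²(X × Y)` stands for `ℓ²(X) ⊗ ℓ²(Y)`. -/
abbrev L2 (X : Type*) : Type _ := lp (fun _ : X => ℂ) 2

/-- The C*-algebra of bounded operators on `ℓ²(X)`. -/
abbrev BL2 (X : Type*) := L2 X →L[ℂ] L2 X

section instances

variable (X : Type*)

instance : NormedAddCommGroup (L2 X) := inferInstance
instance : InnerProductSpace ℂ (L2 X) := inferInstance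
instance : NormedSpace ℂ (L2 X) := inferInstance
instance : SeminormedAddCommGroup (L2 X) := inferInstance
instance : AddCommGroup (L2 X) := inferInstance
instance : AddCommMonoid (L2 X) := inferInstance
instance : Module ℂ (L2 X) := inferInstance
instance : TopologicalSpace (L2 X) := inferInstance
instance : IsTopologicalAddGroup (L2 X) := inferInstance
instance : CompleteSpace (L2 X) := inferInstance
instance : CStarAlgebra (BL2 X) := inferInstance
instance : Ring (BL2 X) := inferInstance
instance : Semiring (BL2 X) := inferInstance
instance : NonUnitalSemiring (BL2 X) := inferInstance
instance : NonUnitalNonAssocSemiring (BL2 X) := inferInstance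
instance : StarRing (BL2 X) := inferInstance
instance : Star (BL2 X) := inferInstance
instance : Algebra ℂ (BL2 X) := inferInstance
instance : Module ℂ (BL2 X) := inferInstance
instance : DistribMulAction ℂ (BL2 X) := inferInstance
instance : StarModule ℂ (BL2 X) := inferInstance
instance : IsScalarTower ℂ (BL2 X) (BL2 X) := inferInstance
instance : SMulCommClass ℂ (BL2 X) (BL2 X) := inferInstance
instance : AddCommMonoid (BL2 X) := inferInstance
instance : NonUnitalRing (BL2 X) := inferInstance
instance : TopologicalSpace (BL2 X) := inferInstance
instance : ContinuousConstSMul ℂ (BL2 X) := inferInstance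
instance : IsTopologicalSemiring (BL2 X) := inferInstance
instance : ContinuousStar (BL2 X) := inferInstance

end instances

variable {X Y Z : Type*}

theorem summable_sq_lp {G : X → Type*} [∀ i, NormedAddCommGroup (G i)] (f : lp G 2) :
    Summable fun i => ‖f i‖ ^ 2 := by
  have := (lp.memℓp f).summable (by norm_num)
  simpa using this

theorem norm_sq_eq_lp {G : X → Type*} [∀ i, NormedAddCommGroup (G i)] (f : lp G 2) :
    ‖f‖ ^ 2 = ∑' x, ‖f x‖ ^ 2 := by
  have := lp.norm_rpow_eq_tsum (p := 2) (by norm_num) f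
  simpa using this

theorem summable_sq (f : L2 X) : Summable fun x => ‖f x‖ ^ 2 := summable_sq_lp f

theorem memℓp_of_sq {f : X → ℂ} (h : Summable fun x => ‖f x‖ ^ 2) :
    Memℓp (E := fun _ : X => ℂ) f 2 := by
  refine memℓp_gen ?_
  simpa using h

theorem norm_sq_eq (f : L2 X) : ‖f‖ ^ 2 = ∑' x, ‖f x‖ ^ 2 := norm_sq_eq_lp f

/-- The unitary `δ_x ↦ φ(x) δ_{e x}`. -/
def monomial (e : X ≃ Y) (φ : X → Circle) : L2 X ≃ₗᵢ[ℂ] L2 Y where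
  toFun f := ⟨fun y => φ (e.symm y) * f (e.symm y), memℓp_of_sq <| by
    simpa [Circle.norm_coe, Function.comp_def] using
      (e.symm.summable_iff (f := fun x => ‖f x‖ ^ 2)).2 (summable_sq f)⟩
  invFun f := ⟨fun x => (φ x)⁻¹ * f (e x), memℓp_of_sq <| by
    simpa [Circle.norm_coe, Function.comp_def] using
      (e.summable_iff (f := fun y => ‖f y‖ ^ 2)).2 (summable_sq f)⟩
  left_inv f := by ext x; simp
  right_inv f := by ext y; simp
  map_add' f g := by ext y; exact mul_add _ _ _
  map_smul' c f := by ext y; simp [mul_left_comm]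
  norm_map' f := by
    refine (sq_eq_sq₀ (norm_nonneg _) (norm_nonneg _)).1 ?_
    rw [norm_sq_eq, norm_sq_eq, ← e.symm.tsum_eq (fun x => ‖f x‖ ^ 2)]
    simp [Circle.norm_coe]

@[simp] theorem monomial_apply (e : X ≃ Y) (φ : X → Circle) (f : L2 X) (y : Y) :
    monomial e φ f y = φ (e.symm y) * f (e.symm y) := rfl

@[simp] theorem monomial_symm_apply (e : X ≃ Y) (φ : X → Circle) (f : L2 Y) (x : X) :
    (monomial e φ).symm f x = (φ x : ℂ)⁻¹ * f (e x) := rfl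

/-- The `y`-th slice `f(y, ·)` of `f ∈ ℓ²(Y × X)`. -/
def slice (y : Y) : L2 (Y × X) →L[ℂ] L2 X :=
  LinearMap.mkContinuous
    { toFun := fun f => ⟨fun x => f (y, x), memℓp_of_sq <|
        (summable_sq f).comp_injective (Prod.mk_right_injective y)⟩
      map_add' := fun f g => rfl
      map_smul' := fun c f => rfl } 1 <| by
    intro f
    rw [one_mul]
    refine (sq_le_sq₀ (norm_nonneg _) (norm_nonneg _)).1 ?_
    rw [norm_sq_eq, norm_sq_eq]
    exact tsum_comp_le_tsum_of_inj (summable_sq f) (fun _ => sq_nonneg _)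
      (Prod.mk_right_injective y)

@[simp] theorem slice_apply (y : Y) (f : L2 (Y × X)) (x : X) : slice y f x = f (y, x) := rfl

theorem hasSum_slice (f : L2 (Y × X)) : HasSum (fun y => ‖slice y f‖ ^ 2) (‖f‖ ^ 2) := by
  have h := summable_sq f
  rw [norm_sq_eq, h.tsum_prod]
  have := (summable_prod_of_nonneg (fun _ => sq_nonneg _)).1 h
  simp_rw [norm_sq_eq]
  exact this.2.hasSum

theorem summable_amp (T : BL2 X) (f : L2 (Y × X)) :
    Summable fun p : Y × X => ‖T (slice p.1 f) p.2‖ ^ 2 := by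
  refine (summable_prod_of_nonneg (fun _ => sq_nonneg _)).2 ⟨fun y => summable_sq (T (slice y f)), ?_⟩
  simp_rw [← norm_sq_eq]
  refine Summable.of_nonneg_of_le (fun _ => sq_nonneg _) (fun y => ?_)
    ((hasSum_slice f).summable.mul_left (‖T‖ ^ 2))
  rw [← mul_pow]
  exact pow_le_pow_left₀ (norm_nonneg _) (T.le_opNorm _) 2

/-- The operator `1 ⊗ T` on `ℓ²(Y × X)`: it applies `T` to every slice. -/
def ampFun (T : BL2 X) : BL2 (Y × X) :=
  LinearMap.mkContinuous
    { toFun := fun f => ⟨fun p => T (slice p.1 f) p.2, memℓp_of_sq (summable_amp T f)⟩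
      map_add' := fun f g => by ext x; simp only [map_add]; rfl
      map_smul' := fun c f => by ext x; simp only [map_smul]; rfl } ‖T‖ <| by
    intro f
    refine (sq_le_sq₀ (norm_nonneg _) (by positivity)).1 ?_
    rw [mul_pow, norm_sq_eq]
    change ∑' p : Y × X, ‖T (slice p.1 f) p.2‖ ^ 2 ≤ _
    rw [(summable_amp T f).tsum_prod, ← (hasSum_slice f).tsum_eq, ← tsum_mul_left]
    simp_rw [← norm_sq_eq]
    have h := (summable_prod_of_nonneg (fun _ => sq_nonneg _)).1 (summable_amp T f)
    simp_rw [← norm_sq_eq] at h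
    refine h.2.tsum_le_tsum (fun y => ?_) ((hasSum_slice f).summable.mul_left _)
    rw [← mul_pow]
    exact pow_le_pow_left₀ (norm_nonneg _) (T.le_opNorm _) 2

@[simp] theorem ampFun_apply (T : BL2 X) (f : L2 (Y × X)) (p : Y × X) :
    ampFun T f p = T (slice p.1 f) p.2 := rfl

@[simp] theorem slice_ampFun (T : BL2 X) (f : L2 (Y × X)) (y : Y) :
    slice y (ampFun T f) = T (slice y f) := by
  ext x; simp

theorem inner_eq_tsum_slice (f g : L2 (Y × X)) :
    inner ℂ f g = ∑' y, inner ℂ (slice y f) (slice y g) := by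
  rw [lp.inner_eq_tsum, (lp.summable_inner (𝕜 := ℂ) f g).tsum_prod]
  simp_rw [lp.inner_eq_tsum, slice_apply]

variable (Y) in
/-- `T ↦ 1 ⊗ T` as a unital star homomorphism `B(ℓ²(X)) → B(ℓ²(Y × X))`. -/
def amp : BL2 X →⋆ₐ[ℂ] BL2 (Y × X) where
  toFun := ampFun
  map_one' := by ext f p; simp
  map_mul' S T := by ext f p; simp
  map_zero' := by ext f p; rfl
  map_add' S T := by ext f p; rfl
  commutes' c := by ext f p; rfl
  map_star' T := by
    refine (ContinuousLinearMap.eq_adjoint_iff _ _).2 fun f g => ?_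
    rw [inner_eq_tsum_slice, inner_eq_tsum_slice]
    simp [ContinuousLinearMap.star_eq_adjoint, ContinuousLinearMap.adjoint_inner_left]

@[simp] theorem amp_apply (T : BL2 X) (f : L2 (Y × X)) (p : Y × X) :
    amp Y T f p = T (slice p.1 f) p.2 := rfl

@[simp] theorem slice_amp (T : BL2 X) (f : L2 (Y × X)) (y : Y) :
    slice y (amp Y T f) = T (slice y f) := slice_ampFun T f y


variable {Γ : Type*} [Group Γ] {J A : Type*}

/-- Conjugation `T ↦ U T U*` by a unitary. -/
def conj (U : L2 X ≃ₗᵢ[ℂ] L2 Y) : BL2 X →⋆ₐ[ℂ] BL2 Y :=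
  (U.conjStarAlgEquiv : BL2 X →⋆ₐ[ℂ] BL2 Y)

@[simp] theorem conj_apply (U : L2 X ≃ₗᵢ[ℂ] L2 Y) (T : BL2 X) (f : L2 Y) :
    conj U T f = U (T (U.symm f)) := rfl

/-- Relabelling of the orthonormal basis along a bijection of the index sets. -/
def reindex (e : X ≃ Y) : BL2 X →⋆ₐ[ℂ] BL2 Y :=
  conj (monomial e fun _ => 1)

variable (Y) in
/-- `S ↦ S ⊗ 1` as a unital star homomorphism `B(ℓ²(X)) → B(ℓ²(X × Y))`. -/
def ampRight : BL2 X →⋆ₐ[ℂ] BL2 (X × Y) :=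
  (reindex (Equiv.prodComm Y X)).comp (amp Y)

/-- The operator `S ⊗ T` on `ℓ²(X × Y)`. -/
def opTensor (S : BL2 X) (T : BL2 Y) : BL2 (X × Y) :=
  ampRight Y S * amp X T

/-- The minimal (spatial) tensor product of two operator algebras: the norm closure of the
algebra generated by the elementary tensors `s ⊗ t`. -/
def minTensor (S : NonUnitalStarSubalgebra ℂ (BL2 X)) (T : NonUnitalStarSubalgebra ℂ (BL2 Y)) :
    NonUnitalStarSubalgebra ℂ (BL2 (X × Y)) :=
  (NonUnitalStarAlgebra.adjoin ℂ {R | ∃ s ∈ S, ∃ t ∈ T, R = opTensor s t}).topologicalClosure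

theorem opTensor_mem_minTensor {S : NonUnitalStarSubalgebra ℂ (BL2 X)}
    {T : NonUnitalStarSubalgebra ℂ (BL2 Y)} {s : BL2 X} {t : BL2 Y} (hs : s ∈ S) (ht : t ∈ T) :
    opTensor s t ∈ minTensor S T :=
  NonUnitalStarSubalgebra.le_topologicalClosure _
    (NonUnitalStarAlgebra.subset_adjoin ℂ _ ⟨s, hs, t, ht, rfl⟩)

/-- Normalized `U(1)`-valued 2-cocycles on the discrete group `Γ`. -/
structure IsTwoCocycle (ω : Γ → Γ → Circle) : Prop where
  cocycle : ∀ g₀ g₁ g₂, ω g₀ g₁ * ω (g₀ * g₁) g₂ = ω g₁ g₂ * ω g₀ (g₁ * g₂)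
  right_one : ∀ g, ω g 1 = 1
  left_one : ∀ g, ω 1 g = 1

/-- The complex conjugate cocycle (inversion and conjugation agree on `U(1)`). -/
def conjCocycle (ω : Γ → Γ → Circle) : Γ → Γ → Circle := fun g h => (ω g h)⁻¹

variable (Γ) in
/-- The trivial cocycle, constantly `1`. -/
def trivialCocycle : Γ → Γ → Circle := fun _ _ => 1

/-- The operator `λ^ω_g : δ_h ↦ ω(g, h) δ_{gh}` on `ℓ²(Γ)`. -/
def twistedReg (ω : Γ → Γ → Circle) (g : Γ) : BL2 Γ :=
  ((monomial (Equiv.mulLeft g) (ω g)).toContinuousLinearEquiv : L2 Γ →L[ℂ] L2 Γ)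

/-- The twisted reduced group C*-algebra `C*_{r,ω}(Γ)`, generated by the `λ^ω_g`. -/
def twistedGroupAlgebra (ω : Γ → Γ → Circle) : NonUnitalStarSubalgebra ℂ (BL2 Γ) :=
  (NonUnitalStarAlgebra.adjoin ℂ (Set.range (twistedReg ω))).topologicalClosure

variable (Γ) in
/-- The reduced group C*-algebra `C*_r(Γ)`, generated by the `λ_g`. -/
def reducedGroupAlgebra : NonUnitalStarSubalgebra ℂ (BL2 Γ) :=
  twistedGroupAlgebra (trivialCocycle Γ)

instance isClosed_reducedGroupAlgebra :
    IsClosed (reducedGroupAlgebra Γ : Set (BL2 Γ)) := isClosed_closure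

/-- For a labelling `d : Y → Γ`, the unitary `∑_y λ_{d y} ⊗ δ_y` on `ℓ²(Γ) ⊗ ℓ²(Y)`. -/
def gradingUnitary (d : Y → Γ) : L2 (Γ × Y) ≃ₗᵢ[ℂ] L2 (Γ × Y) :=
  monomial
    { toFun := fun p => (d p.2 * p.1, p.2)
      invFun := fun p => ((d p.2)⁻¹ * p.1, p.2)
      left_inv := fun p => by simp
      right_inv := fun p => by simp } fun _ => 1

/-- `T ↦ V (1 ⊗ T) V*` with `V = ∑_y λ_{d y} ⊗ δ_y`. For `Y = Γ` and `d = id` its restriction to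
`C*_{r,ω}(Γ)` is the coaction `λ^ω_g ↦ λ_g ⊗ λ^ω_g` (`gradedCoaction_twistedReg`), in particular
the coproduct `δ` for `ω = 1`; for `Y = Γ × J` and `d (h, j) = h` it is `δ ⊗ ι`
(`gradedCoaction_opTensor`). -/
def gradedCoaction (d : Y → Γ) : BL2 Y →⋆ₐ[ℂ] BL2 (Γ × Y) :=
  (conj (gradingUnitary d)).comp (amp Γ)

/-- A (continuous, injective) coaction of `C*_r(Γ)` on the C*-algebra `A`, which is represented on
`ℓ²(J)` by `π`; `C*_r(Γ) ⊗ A` is realized on `ℓ²(Γ) ⊗ ℓ²(J)`. In the field `coassoc`, `Φ` is the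
homomorphism `ι ⊗ α` on `C*_r(Γ) ⊗ A`, determined by its values on elementary tensors, and the
identity is `(ι ⊗ α) ∘ α = (δ ⊗ ι) ∘ α`. The field `continuous` says that `(C*_r(Γ) ⊗ 1) α(A)` is
total in `C*_r(Γ) ⊗ A`. -/
structure Coaction (Γ : Type*) [Group Γ] {A J : Type*} [NonUnitalCStarAlgebra A]
    (π : A →⋆ₙₐ[ℂ] BL2 J) where
  toHom : A →⋆ₙₐ[ℂ] BL2 (Γ × J)
  mem_tensor : ∀ a, toHom a ∈ minTensor (reducedGroupAlgebra Γ) (NonUnitalStarAlgHom.range π)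
  injective : Function.Injective toHom
  coassoc : ∃ Φ : minTensor (reducedGroupAlgebra Γ) (NonUnitalStarAlgHom.range π) →⋆ₙₐ[ℂ]
      BL2 (Γ × (Γ × J)),
    (∀ (x : BL2 Γ) (hx : x ∈ reducedGroupAlgebra Γ) (a : A),
      Φ ⟨opTensor x (π a), opTensor_mem_minTensor hx
        (NonUnitalStarAlgHom.mem_range_self π a)⟩ = opTensor x (toHom a)) ∧
    ∀ a, Φ ⟨toHom a, mem_tensor a⟩ = gradedCoaction (fun p : Γ × J => p.1) (toHom a)
  continuous :
    closure (Submodule.span ℂ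
        {R : BL2 (Γ × J) | ∃ x ∈ reducedGroupAlgebra Γ, ∃ a : A, R = ampRight J x * toHom a} :
        Set (BL2 (Γ × J))) =
      minTensor (reducedGroupAlgebra Γ) (NonUnitalStarAlgHom.range π)

/-- The regular `ω`-representation unitary `W^ω : δ_h ⊗ δ_k ↦ ω(h, k) δ_h ⊗ δ_{hk}`. -/
def regUnitary (ω : Γ → Γ → Circle) : L2 (Γ × Γ) ≃ₗᵢ[ℂ] L2 (Γ × Γ) :=
  monomial
    { toFun := fun p => (p.1, p.1 * p.2)
      invFun := fun p => (p.1, p.1⁻¹ * p.2)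
      left_inv := fun p => by simp
      right_inv := fun p => by simp } fun p => ω p.1 p.2

/-- The homomorphism `x ↦ ∑_h δ_h ⊗ Ad_{h⁻¹}(x)`, implemented by the unitary `W^ω` as
`x ↦ (W^ω)* (1 ⊗ x) W^ω`; see `slice_adCoaction`. -/
def adCoaction (ω : Γ → Γ → Circle) : BL2 Γ →⋆ₐ[ℂ] BL2 (Γ × Γ) :=
  (conj (regUnitary ω).symm).comp (amp Γ)

variable (Γ J) in
/-- The leg embedding `T ↦ T_{12}` into the operators on `ℓ²(Γ) ⊗ ℓ²(J) ⊗ ℓ²(Γ)`. -/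
def leg12 : BL2 (Γ × J) →⋆ₐ[ℂ] BL2 (Γ × (J × Γ)) :=
  (reindex (Equiv.prodAssoc Γ J Γ)).comp (ampRight Γ)

variable (Γ J) in
/-- The leg embedding `T ↦ T_{13}` into the operators on `ℓ²(Γ) ⊗ ℓ²(J) ⊗ ℓ²(Γ)`. -/
def leg13 : BL2 (Γ × Γ) →⋆ₐ[ℂ] BL2 (Γ × (J × Γ)) :=
  (reindex
    { toFun := fun p : J × (Γ × Γ) => (p.2.1, (p.1, p.2.2))
      invFun := fun p : Γ × (J × Γ) => (p.2.1, (p.1, p.2.2))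
      left_inv := fun _ => rfl
      right_inv := fun _ => rfl }).comp (amp J)

variable [NonUnitalCStarAlgebra A] {π : A →⋆ₙₐ[ℂ] BL2 J}

/-- The braided tensor product `A ⊠ C*_{r,ω}(Γ)`: the C*-algebra generated by the operators
`α(a)_{12} (∑_h δ_h ⊗ Ad_{h⁻¹}(x))_{13}`. -/
def braidedTensor (α : Coaction Γ π) (ω : Γ → Γ → Circle) :
    NonUnitalStarSubalgebra ℂ (BL2 (Γ × (J × Γ))) :=
  (NonUnitalStarAlgebra.adjoin ℂ
    {R | ∃ a : A, ∃ x ∈ twistedGroupAlgebra ω,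
      R = leg12 Γ J (α.toHom a) * leg13 Γ J (adCoaction ω x)}).topologicalClosure

variable (Γ J) in
/-- The diagonal coaction of `C*_r(Γ)` on `A ⊠ C*_{r,ω}(Γ)`, implemented by the unitary
`∑ λ_{hm} ⊗ δ_h ⊗ 1 ⊗ δ_m`. On the two kinds of factors of the generators it is given by
`α(a)_{12} ↦ ((δ ⊗ ι)(α(a)))_{123}` (`diagonalCoaction_leg12`) and by applying
`(ι ⊗ Ad)_{124}` to the coaction on `C*_{r,ω}(Γ)` (`diagonalCoaction_leg13`). -/
def diagonalCoaction : BL2 (Γ × (J × Γ)) →⋆ₐ[ℂ] BL2 (Γ × (Γ × (J × Γ))) :=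
  gradedCoaction fun p => p.1 * p.2.2

/-- The deformed algebra `A_ω`: the fixed point algebra `{x | (diagonal coaction) x = 1 ⊗ x}` in
the braided tensor product `A ⊠ C*_{r,ω̄}(Γ)` with the conjugate cocycle. -/
def deformedAlgebra (α : Coaction Γ π) (ω : Γ → Γ → Circle) :
    NonUnitalStarSubalgebra ℂ (BL2 (Γ × (J × Γ))) :=
  braidedTensor α (conjCocycle ω) ⊓
    NonUnitalStarAlgHom.equalizer (diagonalCoaction Γ J) (amp (X := Γ × (J × Γ)) Γ)

section lemmas

@[simp] theorem reindex_apply (e : X ≃ Y) (T : BL2 X) (f : L2 Y) (y : Y) :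
    reindex e T f y = T ((monomial e fun _ => 1).symm f) (e.symm y) := by
  simp [reindex]

@[simp] theorem ampRight_apply (S : BL2 X) (f : L2 (X × Y)) (p : X × Y) :
    ampRight Y S f p = S (slice p.2 ((monomial (Equiv.prodComm Y X) fun _ => 1).symm f)) p.1 := by
  simp [ampRight]

@[simp] theorem gradedCoaction_apply (d : Y → Γ) (T : BL2 Y) (f : L2 (Γ × Y)) (p : Γ × Y) :
    gradedCoaction d T f p = T (slice ((d p.2)⁻¹ * p.1) ((gradingUnitary d).symm f)) p.2 := by
  simp [gradedCoaction, gradingUnitary]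

@[simp] theorem gradingUnitary_symm_apply (d : Y → Γ) (f : L2 (Γ × Y)) (p : Γ × Y) :
    (gradingUnitary d).symm f p = f (d p.2 * p.1, p.2) := by
  simp [gradingUnitary]

@[simp] theorem regUnitary_apply (ω : Γ → Γ → Circle) (f : L2 (Γ × Γ)) (p : Γ × Γ) :
    regUnitary ω f p = ω p.1 (p.1⁻¹ * p.2) * f (p.1, p.1⁻¹ * p.2) := by
  simp [regUnitary]

@[simp] theorem regUnitary_symm_apply (ω : Γ → Γ → Circle) (f : L2 (Γ × Γ)) (p : Γ × Γ) :
    (regUnitary ω).symm f p = (ω p.1 p.2 : ℂ)⁻¹ * f (p.1, p.1 * p.2) := by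
  simp [regUnitary]

@[simp] theorem twistedReg_apply (ω : Γ → Γ → Circle) (g : Γ) (f : L2 Γ) (h : Γ) :
    twistedReg ω g f h = ω g (g⁻¹ * h) * f (g⁻¹ * h) := by
  simp [twistedReg]

theorem star_twistedReg (ω : Γ → Γ → Circle) (g : Γ) :
    star (twistedReg ω g) =
      ((monomial (Equiv.mulLeft g) (ω g)).symm.toContinuousLinearEquiv : L2 Γ →L[ℂ] L2 Γ) := by
  rw [ContinuousLinearMap.star_eq_adjoint, twistedReg]
  exact LinearIsometryEquiv.adjoint_eq_symm _

@[simp] theorem star_twistedReg_apply (ω : Γ → Γ → Circle) (g : Γ) (f : L2 Γ) (h : Γ) :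
    star (twistedReg ω g) f h = (ω g h : ℂ)⁻¹ * f (g * h) := by
  rw [star_twistedReg]; simp

theorem twistedReg_mul {ω : Γ → Γ → Circle} (hω : IsTwoCocycle ω) (g h : Γ) :
    twistedReg ω g * twistedReg ω h = (ω g h : ℂ) • twistedReg ω (g * h) := by
  ext f k
  have := congrArg (fun z : Circle => (z : ℂ)) (hω.cocycle g h (h⁻¹ * (g⁻¹ * k)))
  simp only [Circle.coe_mul, mul_inv_cancel_left] at this
  have e : (g * h)⁻¹ * k = h⁻¹ * (g⁻¹ * k) := by group
  change twistedReg ω g (twistedReg ω h f) k = (ω g h : ℂ) * twistedReg ω (g * h) f k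
  rw [twistedReg_apply, twistedReg_apply, twistedReg_apply, e]
  linear_combination -(f (h⁻¹ * (g⁻¹ * k))) * this

theorem slice_adCoaction (ω : Γ → Γ → Circle) (x : BL2 Γ) (f : L2 (Γ × Γ)) (h : Γ) :
    slice h (adCoaction ω x f) = (star (twistedReg ω h) * x * twistedReg ω h) (slice h f) := by
  ext m
  have : slice h (regUnitary ω f) = twistedReg ω h (slice h f) := by
    ext; simp
  simp [adCoaction, this]

theorem gradedCoaction_twistedReg (ω : Γ → Γ → Circle) (g : Γ) :
    gradedCoaction (id : Γ → Γ) (twistedReg ω g) =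
      opTensor (twistedReg (trivialCocycle Γ) g) (twistedReg ω g) := by
  ext f p
  simp [opTensor, trivialCocycle, mul_assoc]

theorem diagonalCoaction_leg12 (T : BL2 (Γ × J)) :
    diagonalCoaction Γ J (leg12 Γ J T) =
      reindex
        { toFun := fun p : (Γ × (Γ × J)) × Γ => (p.1.1, (p.1.2.1, (p.1.2.2, p.2)))
          invFun := fun p : Γ × (Γ × (J × Γ)) => ((p.1, (p.2.1, p.2.2.1)), p.2.2.2)
          left_inv := fun _ => rfl
          right_inv := fun _ => rfl }
        (ampRight Γ (gradedCoaction (fun p : Γ × J => p.1) T)) := by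
  ext f ⟨k, h, j, m⟩
  simp [diagonalCoaction, leg12]
  refine congrArg (fun v => T v (h, j)) ?_
  ext ⟨h', j'⟩
  simp [mul_assoc]

theorem diagonalCoaction_leg13 (ω : Γ → Γ → Circle) (g : Γ) :
    diagonalCoaction Γ J (leg13 Γ J (adCoaction ω (twistedReg ω g))) =
      opTensor (twistedReg (trivialCocycle Γ) g)
        (leg13 Γ J (adCoaction ω (twistedReg ω g))) := by
  ext f ⟨k, h, j, m⟩
  simp [diagonalCoaction, leg13, adCoaction, opTensor, trivialCocycle, mul_assoc]

theorem gradedCoaction_opTensor (S : BL2 Γ) (T : BL2 J) :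
    gradedCoaction (fun p : Γ × J => p.1) (opTensor S T) =
      reindex (Equiv.prodAssoc Γ Γ J) (opTensor (gradedCoaction (id : Γ → Γ) S) T) := by
  ext f ⟨k, h, j⟩
  simp [opTensor]
  refine congrArg (fun v => S v h) ?_
  ext h'
  simp
  refine congrArg (fun v => T v j) ?_
  ext j'
  simp

theorem continuous_gradedCoaction (d : Y → Γ) : Continuous (gradedCoaction d) :=
  map_continuous (gradedCoaction d)

theorem amp_injective [Nonempty Y] : Function.Injective (amp Y : BL2 X →⋆ₐ[ℂ] BL2 (Y × X)) := by
  classical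
  intro S T h
  obtain ⟨y⟩ := ‹Nonempty Y›
  ext f x
  let F : L2 (Y × X) := ⟨fun p => if p.1 = y then f p.2 else 0, memℓp_of_sq <| by
    refine (summable_prod_of_nonneg (fun _ => sq_nonneg _)).2 ⟨fun y' => ?_, ?_⟩
    · by_cases hy : y' = y
      · simpa [hy] using summable_sq f
      · simp [hy]
    · refine summable_of_ne_finset_zero (s := {y}) fun y' hy' => ?_
      have : y' ≠ y := by simpa using hy'
      simp [this]⟩
  have hF : slice y F = f := by ext x; simp [F]
  have := congrArg (fun R : BL2 (Y × X) => R F (y, x)) h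
  simpa [hF] using this

theorem gradedCoaction_injective (d : Y → Γ) : Function.Injective (gradedCoaction d) := by
  intro S T h
  apply amp_injective (Y := Γ)
  exact (gradingUnitary d).conjStarAlgEquiv.injective h

variable (Γ) in
/-- The defining representation of `C*_r(Γ)` on `ℓ²(Γ)`. -/
def reducedInclusion : reducedGroupAlgebra Γ →⋆ₙₐ[ℂ] BL2 Γ :=
  NonUnitalStarSubalgebraClass.subtype (reducedGroupAlgebra Γ)

@[simp] theorem reducedInclusion_apply (a : reducedGroupAlgebra Γ) :
    reducedInclusion Γ a = a := rfl

theorem range_reducedInclusion :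
    NonUnitalStarAlgHom.range (reducedInclusion Γ) = reducedGroupAlgebra Γ := by
  ext x
  rw [NonUnitalStarAlgHom.mem_range]
  exact ⟨fun ⟨a, ha⟩ => ha ▸ a.2, fun hx => ⟨⟨x, hx⟩, rfl⟩⟩

theorem twistedReg_mem (ω : Γ → Γ → Circle) (g : Γ) : twistedReg ω g ∈ twistedGroupAlgebra ω :=
  NonUnitalStarSubalgebra.le_topologicalClosure _
    (NonUnitalStarAlgebra.subset_adjoin ℂ _ ⟨g, rfl⟩)

theorem isTwoCocycle_trivialCocycle : IsTwoCocycle (trivialCocycle Γ) :=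
  ⟨fun _ _ _ => rfl, fun _ => rfl, fun _ => rfl⟩

theorem adjoin_le_span {S : Set (BL2 X)} (hmul : ∀ a ∈ S, ∀ b ∈ S, a * b ∈ S)
    (hstar : ∀ a ∈ S, star a ∈ S) {x : BL2 X} (hx : x ∈ NonUnitalStarAlgebra.adjoin ℂ S) :
    x ∈ Submodule.span ℂ S := by
  induction hx using NonUnitalStarAlgebra.adjoin_induction with
  | mem x hx => exact Submodule.subset_span hx
  | add x y _ _ hx hy => exact add_mem hx hy
  | zero => exact zero_mem _
  | mul x y _ _ hx hy =>
    have := Submodule.mul_mem_mul hx hy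
    rw [Submodule.span_mul_span] at this
    refine Submodule.span_mono ?_ this
    rintro _ ⟨a, ha, b, hb, rfl⟩
    exact hmul a ha b hb
  | smul c x _ hx => exact Submodule.smul_mem _ c hx
  | star x hx' hx =>
    clear hx'
    induction hx using Submodule.span_induction with
    | mem x hx => exact Submodule.subset_span (hstar x hx)
    | zero => rw [star_zero]; exact zero_mem _
    | add x y _ _ hx hy => rw [star_add]; exact add_mem hx hy
    | smul c x _ hx => rw [star_smul]; exact Submodule.smul_mem _ _ hx

theorem star_twistedReg_trivial (g : Γ) :
    star (twistedReg (trivialCocycle Γ) g) = twistedReg (trivialCocycle Γ) g⁻¹ := by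
  ext f h
  simp [trivialCocycle]

theorem twistedReg_trivial_one : twistedReg (trivialCocycle Γ) 1 = 1 := by
  ext f k
  simp [trivialCocycle]

theorem opTensor_twistedReg_apply (g h : Γ) (f : L2 (Γ × Γ)) (p : Γ × Γ) :
    opTensor (twistedReg (trivialCocycle Γ) g) (twistedReg (trivialCocycle Γ) h) f p =
      f (g⁻¹ * p.1, h⁻¹ * p.2) := by
  simp [opTensor, trivialCocycle]

theorem minTensor_reduced_le :
    (minTensor (reducedGroupAlgebra Γ) (reducedGroupAlgebra Γ) : Set (BL2 (Γ × Γ))) ⊆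
      closure (Submodule.span ℂ {R | ∃ g h : Γ, R =
        opTensor (twistedReg (trivialCocycle Γ) g) (twistedReg (trivialCocycle Γ) h)} :
          Set (BL2 (Γ × Γ))) := by
  set S : Set (BL2 (Γ × Γ)) := {R | ∃ g h : Γ, R =
    opTensor (twistedReg (trivialCocycle Γ) g) (twistedReg (trivialCocycle Γ) h)} with hS
  set Q := (NonUnitalStarAlgebra.adjoin ℂ S).topologicalClosure with hQ
  have hQc : IsClosed (Q : Set (BL2 (Γ × Γ))) := isClosed_closure
  have hgen : ∀ g h : Γ, opTensor (twistedReg (trivialCocycle Γ) g)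
      (twistedReg (trivialCocycle Γ) h) ∈ Q := fun g h =>
    NonUnitalStarSubalgebra.le_topologicalClosure _
      (NonUnitalStarAlgebra.subset_adjoin ℂ _ ⟨g, h, rfl⟩)
  have hone := twistedReg_trivial_one (Γ := Γ)
  have key : ∀ Φ : BL2 Γ →⋆ₐ[ℂ] BL2 (Γ × Γ),
      (∀ g, Φ (twistedReg (trivialCocycle Γ) g) ∈ Q) → ∀ x ∈ reducedGroupAlgebra Γ, Φ x ∈ Q := by
    intro Φ hΦ x hx
    have hcl : IsClosed (Φ ⁻¹' (Q : Set (BL2 (Γ × Γ)))) := hQc.preimage (map_continuous Φ)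
    refine closure_minimal (fun y hy => ?_) hcl hx
    change Φ y ∈ Q
    induction hy using NonUnitalStarAlgebra.adjoin_induction with
    | mem x hx => obtain ⟨g, rfl⟩ := hx; exact hΦ g
    | add x y _ _ hx hy => rw [map_add]; exact add_mem hx hy
    | zero => rw [map_zero]; exact zero_mem _
    | mul x y _ _ hx hy => rw [map_mul]; exact mul_mem hx hy
    | smul c x _ hx => rw [map_smul]; exact SMulMemClass.smul_mem c hx
    | star x _ hx => rw [map_star]; exact star_mem hx
  have hle : (minTensor (reducedGroupAlgebra Γ) (reducedGroupAlgebra Γ) :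
      Set (BL2 (Γ × Γ))) ⊆ Q := by
    refine NonUnitalStarSubalgebra.topologicalClosure_minimal _
      (NonUnitalStarAlgebra.adjoin_le ?_) hQc
    rintro _ ⟨s, hs, t, ht, rfl⟩
    refine mul_mem (key (ampRight Γ) (fun g => ?_) s hs) (key (amp Γ) (fun g => ?_) t ht)
    · simpa [opTensor, hone] using hgen g 1
    · simpa [opTensor, hone] using hgen 1 g
  refine hle.trans (closure_mono fun x hx => adjoin_le_span ?_ ?_ hx)
  · rintro _ ⟨g, h, rfl⟩ _ ⟨g', h', rfl⟩
    refine ⟨g * g', h * h', ?_⟩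
    ext f p
    rw [opTensor_twistedReg_apply, mul_apply_eq_comp, opTensor_twistedReg_apply,
      opTensor_twistedReg_apply]
    simp [mul_assoc]
  · rintro _ ⟨g, h, rfl⟩
    refine ⟨g⁻¹, h⁻¹, ?_⟩
    rw [opTensor, star_mul, ← map_star, ← map_star, star_twistedReg_trivial,
      star_twistedReg_trivial]
    ext f p
    rw [opTensor_twistedReg_apply]
    simp [trivialCocycle]

variable (Γ) in
/-- The coproduct `δ(λ_g) = λ_g ⊗ λ_g` of `C*_r(Γ)`. -/
def coproduct : reducedGroupAlgebra Γ →⋆ₙₐ[ℂ] BL2 (Γ × Γ) :=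
  ((gradedCoaction (id : Γ → Γ)) : BL2 Γ →⋆ₙₐ[ℂ] BL2 (Γ × Γ)).comp (reducedInclusion Γ)

@[simp] theorem coproduct_apply (a : reducedGroupAlgebra Γ) :
    coproduct Γ a = gradedCoaction (id : Γ → Γ) (a : BL2 Γ) := rfl

theorem coproduct_mem (a : reducedGroupAlgebra Γ) :
    coproduct Γ a ∈ minTensor (reducedGroupAlgebra Γ) (reducedGroupAlgebra Γ) := by
  have hcl : IsClosed (gradedCoaction (id : Γ → Γ) ⁻¹' (minTensor (reducedGroupAlgebra Γ)
      (reducedGroupAlgebra Γ) : Set (BL2 (Γ × Γ)))) :=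
    isClosed_closure.preimage (continuous_gradedCoaction _)
  refine closure_minimal (fun y hy => ?_) hcl a.2
  change gradedCoaction (id : Γ → Γ) y ∈ minTensor _ _
  induction hy using NonUnitalStarAlgebra.adjoin_induction with
  | mem x hx =>
    obtain ⟨g, rfl⟩ := hx
    rw [gradedCoaction_twistedReg]
    exact opTensor_mem_minTensor (twistedReg_mem _ g) (twistedReg_mem _ g)
  | add x y _ _ hx hy => rw [map_add]; exact add_mem hx hy
  | zero => rw [map_zero]; exact zero_mem _
  | mul x y _ _ hx hy => rw [map_mul]; exact mul_mem hx hy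
  | smul c x _ hx => rw [map_smul]; exact SMulMemClass.smul_mem c hx
  | star x _ hx => rw [map_star]; exact star_mem hx

variable (Γ) in
/-- The coproduct, as a coaction of `C*_r(Γ)` on itself. -/
def coproductCoaction : Coaction Γ (reducedInclusion Γ) where
  toHom := coproduct Γ
  mem_tensor a := by
    rw [range_reducedInclusion]
    exact coproduct_mem a
  injective a b h := Subtype.ext (gradedCoaction_injective _ h)
  coassoc := by
    refine ⟨(((reindex
      { toFun := fun p : Γ × (Γ × Γ) => (p.2.1, (p.1, p.2.2))
        invFun := fun p : Γ × (Γ × Γ) => (p.2.1, (p.1, p.2.2))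
        left_inv := fun _ => rfl
        right_inv := fun _ => rfl }).comp (gradedCoaction fun p : Γ × Γ => p.2) :
          BL2 (Γ × Γ) →⋆ₐ[ℂ] BL2 (Γ × (Γ × Γ))) :
          BL2 (Γ × Γ) →⋆ₙₐ[ℂ] BL2 (Γ × (Γ × Γ))).comp
        (NonUnitalStarSubalgebraClass.subtype _), fun x hx a => ?_, fun a => ?_⟩
    · ext f ⟨k, h, m⟩
      simp [opTensor]
      refine congrArg (fun v => x v k) ?_
      ext k'
      simp
      refine congrArg (fun v => (a : BL2 Γ) v m) ?_
      ext m'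
      simp
    · ext f ⟨k, h, m⟩
      simp
      refine congrArg (fun v => (a : BL2 Γ) v m) ?_
      ext m'
      simp [mul_assoc]
  continuous := by
    rw [range_reducedInclusion]
    refine Set.Subset.antisymm (closure_minimal ?_ isClosed_closure)
      (minTensor_reduced_le.trans (closure_mono (Submodule.span_mono ?_)))
    · intro y hy
      change y ∈ minTensor (reducedGroupAlgebra Γ) (reducedGroupAlgebra Γ)
      induction hy using Submodule.span_induction with
      | mem y hy =>
        obtain ⟨x, hx, a, rfl⟩ := hy
        refine mul_mem ?_ (coproduct_mem a)
        have : opTensor x (twistedReg (trivialCocycle Γ) 1) ∈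
            minTensor (reducedGroupAlgebra Γ) (reducedGroupAlgebra Γ) :=
          opTensor_mem_minTensor hx (twistedReg_mem _ 1)
        simpa [opTensor, twistedReg_trivial_one] using this
      | zero => exact zero_mem _
      | add x y _ _ hx hy => exact add_mem hx hy
      | smul c x _ hx => exact SMulMemClass.smul_mem c hx
    · rintro _ ⟨g, h, rfl⟩
      refine ⟨twistedReg (trivialCocycle Γ) (g * h⁻¹), twistedReg_mem _ _,
        ⟨twistedReg (trivialCocycle Γ) h, twistedReg_mem _ _⟩, ?_⟩
      rw [coproduct_apply, gradedCoaction_twistedReg]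
      ext f p
      simp [opTensor, trivialCocycle, mul_assoc]

end lemmas

section faithful

theorem exists_positive_functional {A : Type*} [NonUnitalCStarAlgebra A] [PartialOrder A]
    [StarOrderedRing A] {c : A} (hc : 0 ≤ c) (hc0 : c ≠ 0) : ∃ φ : A →ₚ[ℂ] ℂ, φ c ≠ 0 := by
  let C : ProperCone ℝ A :=
    { carrier := {a | 0 ≤ a}
      add_mem' := fun ha hb => add_nonneg ha hb
      zero_mem' := le_rfl
      smul_mem' := fun r a ha => smul_nonneg (r.2 : (0 : ℝ) ≤ r) ha
      isClosed' := CStarAlgebra.isClosed_nonneg }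
  have hnot : -c ∉ C := fun h => hc0 (le_antisymm (neg_nonneg.1 h) hc)
  obtain ⟨f, hf, hfc⟩ := C.hyperplane_separation_point hnot
  let L : A →ₗ[ℂ] ℂ :=
    { toFun := fun a => (f (realPart a : A) : ℂ) + Complex.I * f (imaginaryPart a : A)
      map_add' := fun a b => by
        simp only [map_add, AddSubgroup.coe_add, Complex.ofReal_add]; ring
      map_smul' := fun z a => by
        have h1 : ((realPart (z • a) : selfAdjoint A) : A) =
            z.re • (realPart a : A) - z.im • (imaginaryPart a : A) := by
          rw [realPart_smul]; simp
        have h2 : ((imaginaryPart (z • a) : selfAdjoint A) : A) =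
            z.re • (imaginaryPart a : A) + z.im • (realPart a : A) := by
          rw [imaginaryPart_smul]; simp
        rw [h1, h2]
        simp only [map_sub, map_add, map_smul, smul_eq_mul, RingHom.id_apply]
        apply Complex.ext <;> simp }
  have hL : ∀ a : A, 0 ≤ a → L a = f a := fun a ha => by
    have hs : IsSelfAdjoint a := ha.isSelfAdjoint
    change (f (realPart a : A) : ℂ) + Complex.I * f (imaginaryPart a : A) = f a
    rw [hs.coe_realPart, hs.imaginaryPart]; simp
  refine ⟨PositiveLinearMap.mk₀ L fun a ha => ?_, ?_⟩
  · rw [hL a ha]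
    exact_mod_cast hf a ha
  · change L c ≠ 0
    rw [hL c hc]
    have : f c ≠ 0 := by
      rw [map_neg] at hfc
      linarith
    exact_mod_cast this

section directSum

variable {B ι : Type*} [NonUnitalCStarAlgebra B] {G : ι → Type*}
  [∀ i, NormedAddCommGroup (G i)] [∀ i, InnerProductSpace ℂ (G i)] [∀ i, CompleteSpace (G i)]

theorem direct_sum_bound (ρ : ∀ i, B →⋆ₙₐ[ℂ] (G i →L[ℂ] G i)) (a : B) (f : lp G 2) (i : ι) :
    ‖ρ i a (f i)‖ ^ 2 ≤ ‖a‖ ^ 2 * ‖f i‖ ^ 2 := by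
  rw [← mul_pow]
  refine pow_le_pow_left₀ (norm_nonneg _) (((ρ i a).le_opNorm _).trans ?_) 2
  exact mul_le_mul_of_nonneg_right (NonUnitalStarAlgHom.norm_apply_le (ρ i) a) (norm_nonneg _)

theorem direct_sum_summable (ρ : ∀ i, B →⋆ₙₐ[ℂ] (G i →L[ℂ] G i)) (a : B) (f : lp G 2) :
    Summable fun i => ‖ρ i a (f i)‖ ^ 2 :=
  Summable.of_nonneg_of_le (fun _ => sq_nonneg _) (direct_sum_bound ρ a f)
    ((summable_sq_lp f).mul_left _)

def directSumOp (ρ : ∀ i, B →⋆ₙₐ[ℂ] (G i →L[ℂ] G i)) (a : B) :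
    lp G 2 →L[ℂ] lp G 2 :=
  LinearMap.mkContinuous
    { toFun := fun f => ⟨fun i => ρ i a (f i), memℓp_gen (by
        simpa using direct_sum_summable ρ a f)⟩
      map_add' := fun f g => by ext i; exact map_add _ _ _
      map_smul' := fun c f => by ext i; exact map_smul _ _ _ } ‖a‖ <| by
    intro f
    refine (sq_le_sq₀ (norm_nonneg _) (by positivity)).1 ?_
    rw [mul_pow, norm_sq_eq_lp, norm_sq_eq_lp, ← tsum_mul_left]
    exact (direct_sum_summable ρ a f).tsum_le_tsum (direct_sum_bound ρ a f)
      ((summable_sq_lp f).mul_left _)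

theorem directSumOp_apply (ρ : ∀ i, B →⋆ₙₐ[ℂ] (G i →L[ℂ] G i)) (a : B) (f : lp G 2) (i : ι) :
    directSumOp ρ a f i = ρ i a (f i) := rfl

def directSumRep (ρ : ∀ i, B →⋆ₙₐ[ℂ] (G i →L[ℂ] G i)) :
    B →⋆ₙₐ[ℂ] (lp G 2 →L[ℂ] lp G 2) where
  toFun := directSumOp ρ
  map_zero' := by ext f i; simp [directSumOp_apply]
  map_add' a b := by ext f i; simp [directSumOp_apply]
  map_mul' a b := by ext f i; simp [directSumOp_apply]
  map_smul' c a := by ext f i; simp [directSumOp_apply]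
  map_star' a := by
    refine (ContinuousLinearMap.eq_adjoint_iff _ _).2 fun f g => ?_
    rw [lp.inner_eq_tsum, lp.inner_eq_tsum]
    simp only [directSumOp_apply, map_star, ContinuousLinearMap.star_eq_adjoint,
      ContinuousLinearMap.adjoint_inner_left]
end directSum

def conjHom {H K : Type*} [NormedAddCommGroup H] [InnerProductSpace ℂ H] [CompleteSpace H]
    [NormedAddCommGroup K] [InnerProductSpace ℂ K] [CompleteSpace K] (U : H ≃ₗᵢ[ℂ] K) :
    (H →L[ℂ] H) →⋆ₙₐ[ℂ] (K →L[ℂ] K) where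
  toFun := U.conjStarAlgEquiv
  map_smul' c T := map_smul U.conjStarAlgEquiv c T
  map_zero' := map_zero _
  map_add' := map_add _
  map_mul' := map_mul _
  map_star' := map_star _

/-- A faithful representation on a Hilbert space `H` is unitarily equivalent to one on `ℓ²(J)`, `J`
an orthonormal basis of `H`. -/
theorem exists_l2_representation {A H : Type*} [NonUnitalCStarAlgebra A] [NormedAddCommGroup H]
    [InnerProductSpace ℂ H] [CompleteSpace H] (ρ : A →⋆ₙₐ[ℂ] (H →L[ℂ] H))
    (hρ : Function.Injective ρ) :
    ∃ (J : Set H) (π : A →⋆ₙₐ[ℂ] BL2 J), Function.Injective π := by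
  obtain ⟨w, b, -⟩ := exists_hilbertBasis ℂ H
  refine ⟨w, (conjHom b.repr).comp ρ, ?_⟩
  exact b.repr.conjStarAlgEquiv.injective.comp hρ

/-- Every C*-algebra has a faithful representation on some `ℓ²(J)`. -/
theorem exists_faithful_representation (A : Type u) [NonUnitalCStarAlgebra A] :
    ∃ (J : Type u) (π : A →⋆ₙₐ[ℂ] BL2 J), Function.Injective π := by
  classical
  let _ := CStarAlgebra.spectralOrder A
  have := CStarAlgebra.spectralOrderedRing A
  have hne : ∀ i : {a : A // a ≠ 0}, star (i.1 * star i.1) * (i.1 * star i.1) ≠ 0 := fun i h =>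
    i.2 ((CStarRing.mul_star_self_eq_zero_iff _).1 ((CStarRing.star_mul_self_eq_zero_iff _).1 h))
  choose φ hφ using fun i : {a : A // a ≠ 0} =>
    exists_positive_functional (star_mul_self_nonneg (i.1 * star i.1)) (hne i)
  let R := directSumRep fun i => (φ i).gnsNonUnitalStarAlgHom
  suffices hR : Function.Injective R by
    obtain ⟨J, π, hπ⟩ := exists_l2_representation R hR
    exact ⟨J, π, hπ⟩
  rw [injective_iff_map_eq_zero]
  intro a ha
  by_contra ha0
  let i : {a : A // a ≠ 0} := ⟨a, ha0⟩
  let v : (φ i).GNS := (((φ i).toPreGNS (star a) : (φ i).PreGNS) : (φ i).GNS)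
  have h1 : R a (lp.single (E := fun i => (φ i).GNS) 2 i v) i = 0 := by rw [ha]; rfl
  have h2 : (φ i).gnsNonUnitalStarAlgHom a v = 0 := by
    rw [← h1]
    change _ = (φ i).gnsNonUnitalStarAlgHom a (lp.single (E := fun i => (φ i).GNS) 2 i v i)
    rw [lp.single_apply_self]
  rw [PositiveLinearMap.gnsNonUnitalStarAlgHom_apply_coe] at h2
  have h3 : ‖(φ i).leftMulMapPreGNS a ((φ i).toPreGNS (star a))‖ = 0 := by
    rw [← UniformSpace.Completion.norm_coe, h2, norm_zero]
  have h4 := (φ i).preGNS_norm_sq ((φ i).leftMulMapPreGNS a ((φ i).toPreGNS (star a)))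
  rw [h3] at h4
  apply hφ i
  simpa using h4.symm

end faithful

end

end CocycleDeformation

open CocycleDeformation

namespace CocycleDeformation

noncomputable section

variable {X Y J A : Type*} {Γ : Type*} [Group Γ]

/-! A coaction of `C*_r(Γ)` amounts to a Γ-grading of `A`: its pieces are the spectral subspaces
`A_g`, where `α(a) = λ_g ⊗ a`. The slice maps `compress g` act as Fourier coefficients, since they
send `λ_k ⊗ T` to `T` if `k = g` and to zero otherwise. Coassociativity shows that the coefficients
of `α(a)` come from elements of `A_g` (`exists_compress_eq`), and the density condition in the
definition of a coaction makes the `A_g` total (`mem_closure_span_spectralSubspace`).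

The braided tensor product is therefore the closed span of the products `α(a)_{12} Ad(x)_{13}` with
`a` in `A_g` and `x` a multiple of `λ_k`; the commutation relation `leg13_mul_leg12` is what makes
these products closed under multiplication and adjoints. The diagonal coaction gives such a product
degree `gk`. Taking the coefficient at the identity leaves a fixed point unchanged and kills every
product with `gk ≠ 1`, so the fixed point algebra is the closed span of the products with `k = g⁻¹`
(`deformedAlgebra_eq_closure`).

In both cases an explicit injective homomorphism reaches exactly these products. It is conjugation
by the regular unitary in legs 1 and 3, applied to `α(a)_{12}` when the cocycle is trivial, and to
the flipped coaction `λ^ω_g ⊗ λ_g` of the twisted group algebra in the second case. There the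
cocycle identity reduces all phases to the constant `ω(g⁻¹, g)`. An injective homomorphism of
C*-algebras is isometric, so its range is closed and equals the fixed point algebra
(`range_eq_deformedAlgebra`). -/

theorem continuous_starHom (Φ : BL2 X →⋆ₐ[ℂ] BL2 Y) : Continuous Φ := map_continuous Φ

theorem starHom_smul (Φ : BL2 X →⋆ₐ[ℂ] BL2 Y) (c : ℂ) (T : BL2 X) : Φ (c • T) = c • Φ T :=
  map_smul Φ c T

theorem starHom_add (Φ : BL2 X →⋆ₐ[ℂ] BL2 Y) (S T : BL2 X) : Φ (S + T) = Φ S + Φ T :=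
  map_add Φ S T

/-! ### Elementary tensors and slice maps -/

theorem opTensor_add (S : BL2 X) (T T' : BL2 Y) :
    opTensor S (T + T') = opTensor S T + opTensor S T' := by
  rw [opTensor, starHom_add, mul_add, ← opTensor, ← opTensor]

theorem opTensor_smul (S : BL2 X) (c : ℂ) (T : BL2 Y) :
    opTensor S (c • T) = c • opTensor S T := by
  rw [opTensor, starHom_smul, mul_smul_comm, ← opTensor]

theorem opTensor_zero (S : BL2 X) : opTensor S (0 : BL2 Y) = 0 := by
  rw [opTensor, map_zero, mul_zero]

theorem continuous_opTensor_right (S : BL2 X) : Continuous fun T : BL2 Y => opTensor S T :=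
  continuous_const.mul (continuous_starHom (amp X))

theorem continuous_opTensor_left (T : BL2 Y) : Continuous fun S : BL2 X => opTensor S T :=
  (continuous_starHom (ampRight Y)).mul continuous_const

theorem isLinearMap_opTensor_left (T : BL2 Y) : IsLinearMap ℂ fun S : BL2 X => opTensor S T :=
  ⟨fun S S' => by simp only [opTensor, starHom_add, add_mul],
    fun c S => by simp only [opTensor, starHom_smul, smul_mul_assoc]⟩

theorem opTensor_twistedReg_trivial_apply (g : Γ) (T : BL2 Y) (f : L2 (Γ × Y)) (p : Γ × Y) :
    opTensor (twistedReg (trivialCocycle Γ) g) T f p = T (slice (g⁻¹ * p.1) f) p.2 := by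
  simp [opTensor, trivialCocycle]

theorem slice_opTensor_twistedReg_trivial (g h : Γ) (T : BL2 Y) (f : L2 (Γ × Y)) :
    slice h (opTensor (twistedReg (trivialCocycle Γ) g) T f) = T (slice (g⁻¹ * h) f) := by
  ext y
  simp [opTensor_twistedReg_trivial_apply]

/-- Pairing with the basis vector at `p` reads off the coordinate at `p`, and slicing that vector
gives a basis vector or zero according to its first index. Thus the adjoint is the embedding `f ↦
δ_h ⊗ f`, the column that `compress` needs. -/
theorem adjoint_slice_apply [DecidableEq X] (h : X) (f : L2 Y) (p : X × Y) :
    (slice h : L2 (X × Y) →L[ℂ] L2 Y).adjoint f p = if p.1 = h then f p.2 else 0 := by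
  classical
  have key : slice h (lp.single 2 p (1 : ℂ) : L2 (X × Y)) =
      if p.1 = h then lp.single 2 p.2 (1 : ℂ) else 0 := by
    ext y
    obtain ⟨x, y'⟩ := p
    rw [slice_apply, lp.single_apply]
    by_cases hx : x = h
    · by_cases hy : y = y'
      · subst hx hy; simp
      · simp [hx, hy]
    · simp [hx, Ne.symm hx]
  have h1 := lp.inner_single_left (𝕜 := ℂ) p (1 : ℂ)
    ((slice h : L2 (X × Y) →L[ℂ] L2 Y).adjoint f)
  rw [ContinuousLinearMap.adjoint_inner_right, key] at h1
  split_ifs at h1 ⊢ with hx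
  · rw [lp.inner_single_left] at h1
    simpa using h1.symm
  · simpa using h1.symm

theorem slice_adjoint_slice_of_ne {g h : X} (hgh : g ≠ h) (f : L2 Y) :
    slice g ((slice h : L2 (X × Y) →L[ℂ] L2 Y).adjoint f) = 0 := by
  classical
  ext y
  simp [adjoint_slice_apply, hgh]

theorem slice_adjoint_slice_self (g : X) (f : L2 Y) :
    slice g ((slice g : L2 (X × Y) →L[ℂ] L2 Y).adjoint f) = f := by
  classical
  ext y
  simp [adjoint_slice_apply]

/-- The slice map `T ↦ (⟨δ_g, · δ_1⟩ ⊗ ι) T`. -/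
def compress (g : Γ) : BL2 (Γ × Y) →L[ℂ] BL2 Y :=
  (ContinuousLinearMap.compL ℂ (L2 Y) (L2 (Γ × Y)) (L2 Y) (slice g)).comp
    ((ContinuousLinearMap.compL ℂ (L2 Y) (L2 (Γ × Y)) (L2 (Γ × Y))).flip
      (slice (1 : Γ) : L2 (Γ × Y) →L[ℂ] L2 Y).adjoint)

theorem compress_apply (g : Γ) (T : BL2 (Γ × Y)) (f : L2 Y) :
    compress g T f = slice g (T ((slice (1 : Γ) : L2 (Γ × Y) →L[ℂ] L2 Y).adjoint f)) := rfl

theorem compress_add (g : Γ) (S T : BL2 (Γ × Y)) :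
    compress g (S + T) = compress g S + compress g T := (compress g).map_add S T

theorem compress_smul (g : Γ) (c : ℂ) (T : BL2 (Γ × Y)) : compress g (c • T) = c • compress g T :=
  (compress g).map_smul c T

theorem continuous_compress (g : Γ) : Continuous (compress g : BL2 (Γ × Y) → BL2 Y) :=
  (compress g).continuous

theorem isLinearMap_compress (g : Γ) : IsLinearMap ℂ (compress g : BL2 (Γ × Y) → BL2 Y) :=
  ⟨compress_add g, compress_smul g⟩

theorem compress_opTensor_self (g : Γ) (T : BL2 Y) :
    compress g (opTensor (twistedReg (trivialCocycle Γ) g) T) = T := by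
  ext1 f
  rw [compress_apply, slice_opTensor_twistedReg_trivial, inv_mul_cancel, slice_adjoint_slice_self]

theorem compress_opTensor_of_ne {g k : Γ} (h : k ≠ g) (T : BL2 Y) :
    compress g (opTensor (twistedReg (trivialCocycle Γ) k) T) = 0 := by
  ext1 f
  rw [compress_apply, slice_opTensor_twistedReg_trivial, slice_adjoint_slice_of_ne, map_zero]
  · rfl
  · rwa [Ne, inv_mul_eq_one]

theorem opTensor_twistedReg_trivial_one (T : BL2 Y) :
    opTensor (twistedReg (trivialCocycle Γ) 1) T = amp Γ T := by
  rw [opTensor, twistedReg_trivial_one, map_one, one_mul]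

theorem compress_one_amp (T : BL2 Y) : compress (1 : Γ) (amp Γ T) = T := by
  rw [← opTensor_twistedReg_trivial_one, compress_opTensor_self]

/-- Left translation by `k` in the first leg only relabels the row of `R` that the slice map picks
out. -/
theorem compress_ampRight_mul (g k : Γ) (R : BL2 (Γ × Y)) :
    compress g (ampRight Y (twistedReg (trivialCocycle Γ) k) * R) = compress (k⁻¹ * g) R := by
  ext f y
  simp [compress_apply, trivialCocycle]

/-! ### Degrees of elementary tensors and the commutation relation between legs -/

theorem gradedCoaction_fst_opTensor (g : Γ) (T : BL2 Y) :
    gradedCoaction (fun p : Γ × Y => p.1) (opTensor (twistedReg (trivialCocycle Γ) g) T) =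
      opTensor (twistedReg (trivialCocycle Γ) g) (opTensor (twistedReg (trivialCocycle Γ) g) T) := by
  ext f ⟨k, h, y⟩
  simp only [gradedCoaction_apply, opTensor_twistedReg_trivial_apply]
  refine congrArg (fun v => T v y) ?_
  ext y'
  simp [mul_assoc]

theorem diagonalCoaction_leg12_opTensor (g : Γ) (T : BL2 J) :
    diagonalCoaction Γ J (leg12 Γ J (opTensor (twistedReg (trivialCocycle Γ) g) T)) =
      opTensor (twistedReg (trivialCocycle Γ) g)
        (leg12 Γ J (opTensor (twistedReg (trivialCocycle Γ) g) T)) := by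
  ext f ⟨k, h, j, m⟩
  simp [diagonalCoaction, leg12, opTensor_twistedReg_trivial_apply]
  refine congrArg (fun v => T v j) ?_
  ext j'
  simp [mul_assoc]

/-- The operators `λ^ω_{gh}` and `λ^ω_g λ^ω_h` differ by a scalar of modulus one, which cancels
under conjugation. So a projective representation still gives a genuine action by conjugation. -/
theorem star_twistedReg_conj {ω : Γ → Γ → Circle} (hω : IsTwoCocycle ω) (g h : Γ) (x : BL2 Γ) :
    star (twistedReg ω (g * h)) * x * twistedReg ω (g * h) =
      star (twistedReg ω h) * (star (twistedReg ω g) * x * twistedReg ω g) * twistedReg ω h := by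
  have e : twistedReg ω (g * h) = (ω g h : ℂ)⁻¹ • (twistedReg ω g * twistedReg ω h) := by
    rw [twistedReg_mul hω, smul_smul, inv_mul_cancel₀ (Circle.coe_ne_zero _), one_smul]
  have hc : star ((ω g h : ℂ)⁻¹) * (ω g h : ℂ)⁻¹ = 1 := by
    rw [Complex.star_def, ← Complex.normSq_eq_conj_mul_self, ← Circle.coe_inv, Circle.normSq_coe,
      Complex.ofReal_one]
  rw [e, star_smul, star_mul, smul_mul_assoc, smul_mul_assoc, mul_smul_comm, smul_smul, hc,
    one_smul]
  simp only [mul_assoc]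

theorem adCoaction_apply (ω : Γ → Γ → Circle) (x : BL2 Γ) (f : L2 (Γ × Γ)) (p : Γ × Γ) :
    adCoaction ω x f p = (star (twistedReg ω p.1) * x * twistedReg ω p.1) (slice p.1 f) p.2 := by
  rw [← slice_adCoaction, slice_apply]

theorem leg13_adCoaction_apply (ω : Γ → Γ → Circle) (x : BL2 Γ) (f : L2 (Γ × (J × Γ))) (h : Γ)
    (j : J) (m : Γ) :
    leg13 Γ J (adCoaction ω x) f (h, j, m) =
      (star (twistedReg ω h) * x * twistedReg ω h) (slice j (slice h f)) m := by
  simp only [leg13, StarAlgHom.comp_apply, reindex_apply, amp_apply]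
  refine (adCoaction_apply ω x _ (h, m)).trans ?_
  refine congrArg (fun v => (star (twistedReg ω h) * x * twistedReg ω h) v m) ?_
  ext k
  simp

theorem leg12_opTensor_apply (g : Γ) (T : BL2 J) (f : L2 (Γ × (J × Γ))) (h : Γ) (j : J) (m : Γ) :
    leg12 Γ J (opTensor (twistedReg (trivialCocycle Γ) g) T) f (h, j, m) =
      T (slice m ((monomial (Equiv.prodComm Γ J) fun _ => 1).symm (slice (g⁻¹ * h) f))) j := by
  simp [leg12, opTensor_twistedReg_trivial_apply]
  refine congrArg (fun v => T v j) ?_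
  ext j'
  simp

/-- In the fibre over `h`, the left factor conjugates by `λ^ω_h`, but `λ_g` carries the fibre over
`g⁻¹h` to the one over `h`. Splitting `h = g(g⁻¹h)` leaves one conjugation by `λ^ω_g`, which is the
price of exchanging the factors. -/
theorem leg13_mul_leg12 {ω : Γ → Γ → Circle} (hω : IsTwoCocycle ω) (g k : Γ) (T : BL2 J) :
    leg13 Γ J (adCoaction ω (twistedReg ω k)) *
        leg12 Γ J (opTensor (twistedReg (trivialCocycle Γ) g) T) =
      leg12 Γ J (opTensor (twistedReg (trivialCocycle Γ) g) T) *
        leg13 Γ J (adCoaction ω (star (twistedReg ω g) * twistedReg ω k * twistedReg ω g)) := by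
  ext f ⟨h, j, m⟩
  have hc := star_twistedReg_conj hω g (g⁻¹ * h) (twistedReg ω k)
  rw [mul_inv_cancel_left] at hc
  rw [mul_apply_eq_comp, mul_apply_eq_comp, leg13_adCoaction_apply, leg12_opTensor_apply,
    mul_apply_eq_comp, mul_apply_eq_comp, star_twistedReg_apply, twistedReg_apply, twistedReg_apply,
    slice_apply, slice_apply, leg12_opTensor_apply]
  have hT : ∀ (c : ℂ) (v : L2 J), c * T v j = T (c • v) j := fun c v => by rw [map_smul]; rfl
  rw [hT, hT, hT]
  refine congrArg (fun v => T v j) ?_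
  ext j'
  simp only [lp.coeFn_smul, Pi.smul_apply, smul_eq_mul, slice_apply, monomial_symm_apply,
    Equiv.prodComm_apply, Prod.swap_prod_mk, leg13_adCoaction_apply, ← hc]
  simp [mul_assoc]

-- Density arguments and the linear span of the twisted translations

local instance instNormedAddCommGroupOperators : NormedAddCommGroup (BL2 X) := inferInstance

local instance instNormedSpaceOperators : NormedSpace ℂ (BL2 X) := inferInstance

local instance instSMulSubalgebra (N : NonUnitalStarSubalgebra ℂ (BL2 X)) : SMul ℂ N := inferInstance

/-- The common form of the density arguments: a closed condition that is linear in the element need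
only be checked on a total set. -/
theorem map_mem_of_mem_closure_span {E F : Type*} [NormedAddCommGroup E] [NormedSpace ℂ E]
    [NormedAddCommGroup F] [NormedSpace ℂ F] {φ : E → F} (hφ : IsLinearMap ℂ φ)
    (hc : Continuous φ) {S : Set E} {K : Submodule ℂ F} (hK : IsClosed (K : Set F))
    (h : ∀ s ∈ S, φ s ∈ K) {x : E} (hx : x ∈ closure (Submodule.span ℂ S : Set E)) :
    φ x ∈ K := by
  refine closure_minimal (t := φ ⁻¹' K) (fun y hy => ?_) (hK.preimage hc) hx
  have : Submodule.span ℂ S ≤ K.comap hφ.mk' := Submodule.span_le.2 h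
  exact this hy

theorem continuous_representation {B : Type*} [NonUnitalCStarAlgebra B] (ρ : B →⋆ₙₐ[ℂ] BL2 X) :
    Continuous ρ :=
  AddMonoidHomClass.continuous_of_bound ρ 1 fun b => by
    rw [one_mul]
    exact NonUnitalStarAlgHom.norm_apply_le ρ b

theorem isLinearMap_representation {B : Type*} [NonUnitalCStarAlgebra B] (ρ : B →⋆ₙₐ[ℂ] BL2 X) :
    IsLinearMap ℂ ρ :=
  ⟨map_add ρ, map_smul ρ⟩

theorem twistedReg_one {ω : Γ → Γ → Circle} (hω : IsTwoCocycle ω) : twistedReg ω 1 = 1 := by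
  ext f k
  simp [hω.left_one]

theorem star_twistedReg_mul_self (ω : Γ → Γ → Circle) (g : Γ) :
    star (twistedReg ω g) * twistedReg ω g = 1 := by
  ext f k
  simp

theorem mul_mem_span_twistedReg {ω : Γ → Γ → Circle} (hω : IsTwoCocycle ω) {g h : Γ} {x y : BL2 Γ}
    (hx : x ∈ Submodule.span ℂ {twistedReg ω g}) (hy : y ∈ Submodule.span ℂ {twistedReg ω h}) :
    x * y ∈ Submodule.span ℂ {twistedReg ω (g * h)} := by
  obtain ⟨c, rfl⟩ := Submodule.mem_span_singleton.1 hx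
  obtain ⟨d, rfl⟩ := Submodule.mem_span_singleton.1 hy
  rw [smul_mul_assoc, mul_smul_comm, twistedReg_mul hω]
  exact Submodule.smul_mem _ _ (Submodule.smul_mem _ _ (Submodule.smul_mem _ _
    (Submodule.mem_span_singleton_self _)))

/-- Since `λ^ω_g λ^ω_{g⁻¹}` is the scalar `ω(g, g⁻¹)`, the adjoint is the inverse up to that phase.
-/
theorem star_twistedReg_eq {ω : Γ → Γ → Circle} (hω : IsTwoCocycle ω) (g : Γ) :
    star (twistedReg ω g) = (ω g g⁻¹ : ℂ)⁻¹ • twistedReg ω g⁻¹ := by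
  have h : star (twistedReg ω g) * (twistedReg ω g * twistedReg ω g⁻¹) = twistedReg ω g⁻¹ := by
    rw [← mul_assoc, star_twistedReg_mul_self, one_mul]
  rw [← h, twistedReg_mul hω, mul_inv_cancel, twistedReg_one hω, mul_smul_comm, mul_one, smul_smul,
    inv_mul_cancel₀ (Circle.coe_ne_zero _), one_smul]

theorem star_mem_span_twistedReg {ω : Γ → Γ → Circle} (hω : IsTwoCocycle ω) {g : Γ} {x : BL2 Γ}
    (hx : x ∈ Submodule.span ℂ {twistedReg ω g}) :
    star x ∈ Submodule.span ℂ {twistedReg ω g⁻¹} := by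
  obtain ⟨c, rfl⟩ := Submodule.mem_span_singleton.1 hx
  rw [star_smul, star_twistedReg_eq hω]
  exact Submodule.smul_mem _ _ (Submodule.smul_mem _ _ (Submodule.mem_span_singleton_self _))

/-- The operators `λ^ω_g` are closed under products and adjoints only up to phases. Replacing each
by the line it spans gives a set that is closed on the nose and has the same linear span, so
`adjoin_le_span` applies. -/
theorem twistedGroupAlgebra_subset {ω : Γ → Γ → Circle} (hω : IsTwoCocycle ω) :
    (twistedGroupAlgebra ω : Set (BL2 Γ)) ⊆
      closure (Submodule.span ℂ (Set.range (twistedReg ω)) : Set (BL2 Γ)) := by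
  have hle (g : Γ) : Submodule.span ℂ {twistedReg ω g} ≤
      Submodule.span ℂ (Set.range (twistedReg ω)) :=
    Submodule.span_mono (Set.singleton_subset_iff.2 ⟨g, rfl⟩)
  have key : NonUnitalStarAlgebra.adjoin ℂ (Set.range (twistedReg ω)) ≤
      NonUnitalStarAlgebra.adjoin ℂ (⋃ g, (Submodule.span ℂ {twistedReg ω g} : Set (BL2 Γ))) :=
    NonUnitalStarAlgebra.adjoin_mono (by
      rintro _ ⟨g, rfl⟩
      exact Set.mem_iUnion.2 ⟨g, Submodule.mem_span_singleton_self _⟩)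
  refine closure_mono fun x hx => ?_
  have := adjoin_le_span ?_ ?_ (key hx)
  · refine Submodule.span_le.2 ?_ this
    exact Set.iUnion_subset hle
  · intro a ha b hb
    obtain ⟨g, ha⟩ := Set.mem_iUnion.1 ha
    obtain ⟨h, hb⟩ := Set.mem_iUnion.1 hb
    exact Set.mem_iUnion.2 ⟨g * h, mul_mem_span_twistedReg hω ha hb⟩
  · intro a ha
    obtain ⟨g, ha⟩ := Set.mem_iUnion.1 ha
    exact Set.mem_iUnion.2 ⟨g⁻¹, star_mem_span_twistedReg hω ha⟩

/-! ### Spectral decomposition of a coaction -/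

variable [NonUnitalCStarAlgebra A] {π : A →⋆ₙₐ[ℂ] BL2 J}

/-- The spectral subspace `{a | α(a) = λ_g ⊗ a}`. -/
def spectralSubspace (α : Coaction Γ π) (g : Γ) : Submodule ℂ A where
  carrier := {a | α.toHom a = opTensor (twistedReg (trivialCocycle Γ) g) (π a)}
  add_mem' {a b} ha hb := by
    rw [Set.mem_ofPred_eq] at *
    rw [map_add, map_add, ha, hb, opTensor_add]
  zero_mem' := by rw [Set.mem_ofPred_eq, map_zero, map_zero, opTensor_zero]
  smul_mem' c a ha := by
    rw [Set.mem_ofPred_eq] at *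
    rw [map_smul, map_smul, ha, opTensor_smul]

theorem mem_spectralSubspace {α : Coaction Γ π} {g : Γ} {a : A} :
    a ∈ spectralSubspace α g ↔
      α.toHom a = opTensor (twistedReg (trivialCocycle Γ) g) (π a) := Iff.rfl

theorem opTensor_twistedReg_trivial_mul (g h : Γ) (S T : BL2 Y) :
    opTensor (twistedReg (trivialCocycle Γ) g) S * opTensor (twistedReg (trivialCocycle Γ) h) T =
      opTensor (twistedReg (trivialCocycle Γ) (g * h)) (S * T) := by
  ext f p
  rw [mul_apply_eq_comp, opTensor_twistedReg_trivial_apply, slice_opTensor_twistedReg_trivial,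
    opTensor_twistedReg_trivial_apply, mul_inv_rev, mul_assoc, mul_apply_eq_comp]

theorem star_opTensor_twistedReg_trivial (g : Γ) (T : BL2 Y) :
    star (opTensor (twistedReg (trivialCocycle Γ) g) T) =
      opTensor (twistedReg (trivialCocycle Γ) g⁻¹) (star T) := by
  have : amp Γ (star T) * ampRight Y (twistedReg (trivialCocycle Γ) g⁻¹) =
      opTensor (twistedReg (trivialCocycle Γ) g⁻¹) (star T) := by
    ext f p
    rw [opTensor_twistedReg_trivial_apply, mul_apply_eq_comp, amp_apply]
    refine congrArg (fun v => star T v p.2) ?_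
    ext y
    simp [trivialCocycle]
  rw [opTensor, star_mul, ← map_star, ← map_star, star_twistedReg_trivial, this]

theorem mul_mem_spectralSubspace {α : Coaction Γ π} {g h : Γ} {a b : A}
    (ha : a ∈ spectralSubspace α g) (hb : b ∈ spectralSubspace α h) :
    a * b ∈ spectralSubspace α (g * h) := by
  rw [mem_spectralSubspace] at *
  rw [map_mul, ha, hb, opTensor_twistedReg_trivial_mul, map_mul]

theorem star_mem_spectralSubspace {α : Coaction Γ π} {g : Γ} {a : A}
    (ha : a ∈ spectralSubspace α g) : star a ∈ spectralSubspace α g⁻¹ := by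
  rw [mem_spectralSubspace] at *
  rw [map_star, ha, star_opTensor_twistedReg_trivial, map_star]

local instance isClosed_twistedGroupAlgebra (ω : Γ → Γ → Circle) :
    IsClosed (twistedGroupAlgebra ω : Set (BL2 Γ)) := isClosed_closure

local instance isClosed_minTensor (S : NonUnitalStarSubalgebra ℂ (BL2 X))
    (T : NonUnitalStarSubalgebra ℂ (BL2 Y)) :
    IsClosed (minTensor S T : Set (BL2 (X × Y))) := isClosed_closure

/-- Transfers density from the ambient operator algebra to the subspace topology. This is needed for
maps that are defined only on a subalgebra, such as `Φ` in the coassociativity condition. -/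
theorem mem_closure_span_coe {N : NonUnitalStarSubalgebra ℂ (BL2 X)} {S : Set (BL2 X)}
    (hS : S ⊆ N) (x : N) (hx : (x : BL2 X) ∈ closure (Submodule.span ℂ S : Set (BL2 X))) :
    x ∈ closure (Submodule.span ℂ {y : N | (y : BL2 X) ∈ S} : Set N) := by
  rw [closure_subtype]
  refine closure_mono (fun y hy => ?_) hx
  induction hy using Submodule.span_induction with
  | mem y hy => exact ⟨⟨y, hS hy⟩, Submodule.subset_span hy, rfl⟩
  | zero => exact ⟨0, zero_mem _, rfl⟩
  | add y z _ _ hy hz =>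
    obtain ⟨y, hy, rfl⟩ := hy
    obtain ⟨z, hz, rfl⟩ := hz
    exact ⟨y + z, add_mem hy hz, rfl⟩
  | smul c y _ hy =>
    obtain ⟨y, hy, rfl⟩ := hy
    exact ⟨c • y, Submodule.smul_mem _ c hy, rfl⟩

variable (Γ π) in
/-- The elementary tensors `λ_g ⊗ π(a)`. -/
def elementaryTensors : Set (BL2 (Γ × J)) :=
  {R | ∃ (g : Γ) (a : A), R = opTensor (twistedReg (trivialCocycle Γ) g) (π a)}

/-- Elements of `C*_r(Γ)` are limits of combinations of the `λ_g`, and the tensors `λ_g ⊗ π(a)` are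
already closed under products and adjoints. -/
theorem minTensor_subset :
    (minTensor (reducedGroupAlgebra Γ) (NonUnitalStarAlgHom.range π) : Set (BL2 (Γ × J))) ⊆
      closure (Submodule.span ℂ (elementaryTensors Γ π) : Set (BL2 (Γ × J))) := by
  set Q := (NonUnitalStarAlgebra.adjoin ℂ (elementaryTensors Γ π)).topologicalClosure
  have hQc : IsClosed (Q.toSubmodule : Set (BL2 (Γ × J))) := isClosed_closure
  have hle : minTensor (reducedGroupAlgebra Γ) (NonUnitalStarAlgHom.range π) ≤ Q := by
    refine NonUnitalStarSubalgebra.topologicalClosure_minimal _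
      (NonUnitalStarAlgebra.adjoin_le ?_) hQc
    rintro _ ⟨s, hs, _, ⟨a, rfl⟩, rfl⟩
    refine map_mem_of_mem_closure_span (isLinearMap_opTensor_left (π a))
      (continuous_opTensor_left (π a)) hQc ?_
      (twistedGroupAlgebra_subset isTwoCocycle_trivialCocycle hs)
    rintro _ ⟨g, rfl⟩
    exact NonUnitalStarSubalgebra.le_topologicalClosure _
      (NonUnitalStarAlgebra.subset_adjoin ℂ _ ⟨g, a, rfl⟩)
  refine Set.Subset.trans hle (closure_mono fun x hx => adjoin_le_span ?_ ?_ hx)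
  · rintro _ ⟨g, a, rfl⟩ _ ⟨h, b, rfl⟩
    exact ⟨g * h, a * b, by rw [opTensor_twistedReg_trivial_mul, map_mul]⟩
  · rintro _ ⟨g, a, rfl⟩
    exact ⟨g⁻¹, star a, by rw [star_opTensor_twistedReg_trivial, map_star]⟩

theorem elementaryTensors_subset :
    elementaryTensors Γ π ⊆ minTensor (reducedGroupAlgebra Γ) (NonUnitalStarAlgHom.range π) := by
  rintro _ ⟨g, a, rfl⟩
  exact opTensor_mem_minTensor (twistedReg_mem _ g) (NonUnitalStarAlgHom.mem_range_self π a)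

/-- `δ ⊗ ι` intertwines the slice maps on `C*_r(Γ) ⊗ A`. -/
theorem compress_gradedCoaction (g : Γ) {R : BL2 (Γ × J)}
    (hR : R ∈ minTensor (reducedGroupAlgebra Γ) (NonUnitalStarAlgHom.range π)) :
    compress g (gradedCoaction (fun p : Γ × J => p.1) R) =
      opTensor (twistedReg (trivialCocycle Γ) g) (compress g R) := by
  have key := map_mem_of_mem_closure_span (K := (⊥ : Submodule ℂ (BL2 (Γ × J))))
    (φ := fun R => compress g (gradedCoaction (fun p : Γ × J => p.1) R) -
      opTensor (twistedReg (trivialCocycle Γ) g) (compress g R))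
    ⟨fun a b => ?_, fun c a => ?_⟩ ?_ isClosed_singleton ?_ (minTensor_subset hR)
  · exact sub_eq_zero.1 key
  · rw [starHom_add, compress_add, compress_add, opTensor_add]
    abel
  · rw [starHom_smul, compress_smul, compress_smul, opTensor_smul, smul_sub]
  · exact ((continuous_compress g).comp (continuous_gradedCoaction _)).sub
      ((continuous_opTensor_right _).comp (continuous_compress g))
  · rintro _ ⟨k, a, rfl⟩
    rw [Submodule.mem_bot, sub_eq_zero, gradedCoaction_fst_opTensor]
    by_cases hk : k = g
    · rw [hk, compress_opTensor_self, compress_opTensor_self]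
    · rw [compress_opTensor_of_ne hk, compress_opTensor_of_ne hk, opTensor_zero]

/-- The pair of maps `compress g` and `compress g ∘ Φ` sends `λ_k ⊗ π(b)` to `(π(b), α(b))` if `k =
g` and to zero otherwise, so it takes values in the set of all such pairs. Applied to `α(a)`, it
yields a single `b` for both coordinates, and coassociativity identifies the second one with `λ_g ⊗
π(b)`. -/
theorem exists_compress_eq (hπ : Function.Injective π) (α : Coaction Γ π) (g : Γ) (a : A) :
    ∃ b ∈ spectralSubspace α g, π b = compress g (α.toHom a) := by
  obtain ⟨Φ, hΦ, hΦα⟩ := α.coassoc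
  let K : Submodule ℂ (BL2 J × BL2 (Γ × J)) :=
    LinearMap.range (LinearMap.prod (IsLinearMap.mk' π (isLinearMap_representation π))
      (IsLinearMap.mk' α.toHom (isLinearMap_representation α.toHom)))
  -- Both `π` and `α` are isometric, hence so is the map to pairs with the maximum norm, and its
  -- range is closed.
  have hK : IsClosed (K : Set (BL2 J × BL2 (Γ × J))) := by
    have : Isometry fun b => (π b, α.toHom b) := by
      refine Isometry.of_dist_eq fun b c => ?_
      rw [Prod.dist_eq, (NonUnitalStarAlgHom.isometry π hπ).dist_eq,
        (NonUnitalStarAlgHom.isometry α.toHom α.injective).dist_eq, max_self]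
    exact this.isClosedEmbedding.isClosed_range
  have key := map_mem_of_mem_closure_span (K := K)
    (φ := fun R : minTensor (reducedGroupAlgebra Γ) (NonUnitalStarAlgHom.range π) =>
      (compress g (R : BL2 (Γ × J)), compress g (Φ R)))
    ⟨fun R S => ?_, fun c R => ?_⟩ ?_ hK ?_
    (mem_closure_span_coe elementaryTensors_subset ⟨α.toHom a, α.mem_tensor a⟩
      (minTensor_subset (α.mem_tensor a)))
  · obtain ⟨b, hb⟩ := key
    have h₁ : π b = compress g (α.toHom a) := congrArg Prod.fst hb
    have h₂ : α.toHom b = compress g (Φ ⟨α.toHom a, α.mem_tensor a⟩) := congrArg Prod.snd hb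
    refine ⟨b, ?_, h₁⟩
    rw [mem_spectralSubspace, h₂, hΦα, compress_gradedCoaction g (α.mem_tensor a), h₁]
  · rw [map_add Φ, compress_add]
    exact Prod.ext (compress_add g _ _) rfl
  · have h : Φ (c • R) = c • Φ R := map_smul Φ c R
    rw [h, compress_smul]
    exact Prod.ext (compress_smul g _ _) rfl
  · exact ((continuous_compress g).comp continuous_subtype_val).prodMk
      ((continuous_compress g).comp (continuous_representation Φ))
  · rintro ⟨R, hR⟩ ⟨k, b, rfl⟩
    have h := hΦ _ (twistedReg_mem _ k) b
    simp only [h]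
    by_cases hk : k = g
    · rw [hk, compress_opTensor_self, compress_opTensor_self]
      exact ⟨b, rfl⟩
    · rw [compress_opTensor_of_ne hk, compress_opTensor_of_ne hk]
      exact zero_mem K

/-- The spectral subspaces of a coaction are total. -/
theorem mem_closure_span_spectralSubspace (hπ : Function.Injective π) (α : Coaction Γ π) (a : A) :
    a ∈ closure (Submodule.span ℂ (⋃ g, (spectralSubspace α g : Set A)) : Set A) := by
  set D := Submodule.span ℂ (⋃ g, (spectralSubspace α g : Set A))
  rw [(NonUnitalStarAlgHom.isometry π hπ).isEmbedding.closure_eq_preimage_closure_image]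
  let K : Submodule ℂ (BL2 J) :=
    (D.map (IsLinearMap.mk' π (isLinearMap_representation π))).topologicalClosure
  have hK : IsClosed (K : Set (BL2 J)) := isClosed_closure
  change π a ∈ K
  -- The element `π(a)` is recovered from `1 ⊗ π(a)` by slicing, and `1 ⊗ π(a)` is a limit of
  -- combinations of products from `(C*_r(Γ) ⊗ 1) α(A)`.
  rw [← compress_one_amp (Γ := Γ) (π a), ← opTensor_twistedReg_trivial_one]
  have ha : opTensor (twistedReg (trivialCocycle Γ) 1) (π a) ∈
      closure (Submodule.span ℂ {R : BL2 (Γ × J) | ∃ x ∈ reducedGroupAlgebra Γ, ∃ a : A,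
        R = ampRight J x * α.toHom a} : Set (BL2 (Γ × J))) := by
    rw [α.continuous]
    exact elementaryTensors_subset ⟨1, a, rfl⟩
  refine map_mem_of_mem_closure_span (isLinearMap_compress 1) (continuous_compress 1) hK ?_ ha
  rintro _ ⟨x, hx, b, rfl⟩
  refine map_mem_of_mem_closure_span (φ := fun x => compress (1 : Γ) (ampRight J x * α.toHom b))
    ⟨fun x y => ?_, fun c x => ?_⟩ ?_ hK ?_
    (twistedGroupAlgebra_subset isTwoCocycle_trivialCocycle hx)
  · rw [starHom_add, add_mul, compress_add]
  · rw [starHom_smul, smul_mul_assoc, compress_smul]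
  · exact (continuous_compress 1).comp ((continuous_starHom _).mul continuous_const)
  · rintro _ ⟨k, rfl⟩
    -- Slicing `(λ_k ⊗ 1) α(b)` at the identity gives the coefficient of `α(b)` at `k⁻¹`, which
    -- comes from a spectral subspace.
    obtain ⟨d, hd, hdb⟩ := exists_compress_eq hπ α (k⁻¹ * 1) b
    rw [compress_ampRight_mul, ← hdb]
    exact Submodule.le_topologicalClosure _
      ⟨d, Submodule.subset_span (Set.mem_iUnion.2 ⟨_, hd⟩), rfl⟩

/-! ### Multiplication, adjoint and degree of homogeneous products -/

/-- The product `α(a)_{12} Ad(x)_{13}`. -/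
def braidedProduct (α : Coaction Γ π) (ω : Γ → Γ → Circle) (a : A) (x : BL2 Γ) :
    BL2 (Γ × (J × Γ)) :=
  leg12 Γ J (α.toHom a) * leg13 Γ J (adCoaction ω x)

theorem braidedProduct_smul (α : Coaction Γ π) (ω : Γ → Γ → Circle) (a : A) (c : ℂ) (x : BL2 Γ) :
    braidedProduct α ω a (c • x) = c • braidedProduct α ω a x := by
  rw [braidedProduct, starHom_smul, starHom_smul, mul_smul_comm, ← braidedProduct]

section homogeneous

variable {α : Coaction Γ π} {ω : Γ → Γ → Circle}

theorem leg13_mul_leg12_toHom (hω : IsTwoCocycle ω) {g k : Γ} {a : A} {x : BL2 Γ}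
    (ha : a ∈ spectralSubspace α g) (hx : x ∈ Submodule.span ℂ {twistedReg ω k}) :
    leg13 Γ J (adCoaction ω x) * leg12 Γ J (α.toHom a) =
      braidedProduct α ω a (star (twistedReg ω g) * x * twistedReg ω g) := by
  obtain ⟨c, rfl⟩ := Submodule.mem_span_singleton.1 hx
  rw [mul_smul_comm, smul_mul_assoc, braidedProduct_smul, braidedProduct, starHom_smul,
    starHom_smul, smul_mul_assoc, ha, leg13_mul_leg12 hω]

theorem braidedProduct_mul (hω : IsTwoCocycle ω) {g k : Γ} {a b : A} {x y : BL2 Γ}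
    (hb : b ∈ spectralSubspace α g) (hx : x ∈ Submodule.span ℂ {twistedReg ω k}) :
    braidedProduct α ω a x * braidedProduct α ω b y =
      braidedProduct α ω (a * b) (star (twistedReg ω g) * x * twistedReg ω g * y) := by
  have h := leg13_mul_leg12_toHom hω hb hx
  rw [braidedProduct] at h
  rw [braidedProduct, braidedProduct, mul_assoc, ← mul_assoc (leg13 Γ J _), h, braidedProduct]
  simp only [map_mul, mul_assoc]

theorem star_braidedProduct (hω : IsTwoCocycle ω) {g k : Γ} {a : A} {x : BL2 Γ}
    (ha : a ∈ spectralSubspace α g) (hx : x ∈ Submodule.span ℂ {twistedReg ω k}) :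
    star (braidedProduct α ω a x) =
      braidedProduct α ω (star a) (star (twistedReg ω g⁻¹) * star x * twistedReg ω g⁻¹) := by
  rw [braidedProduct, star_mul, ← map_star, ← map_star, ← map_star, ← map_star,
    leg13_mul_leg12_toHom hω (star_mem_spectralSubspace ha) (star_mem_span_twistedReg hω hx)]

/-- Degrees multiply: the first factor contributes `λ_g` to the new leg and the second contributes
`λ_k`. -/
theorem diagonalCoaction_braidedProduct {g k : Γ} {a : A} {x : BL2 Γ}
    (ha : a ∈ spectralSubspace α g) (hx : x ∈ Submodule.span ℂ {twistedReg ω k}) :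
    diagonalCoaction Γ J (braidedProduct α ω a x) =
      opTensor (twistedReg (trivialCocycle Γ) (g * k)) (braidedProduct α ω a x) := by
  obtain ⟨c, rfl⟩ := Submodule.mem_span_singleton.1 hx
  rw [braidedProduct_smul, starHom_smul, opTensor_smul, braidedProduct, ha, map_mul,
    diagonalCoaction_leg12_opTensor, diagonalCoaction_leg13, opTensor_twistedReg_trivial_mul]

theorem conj_mem_span_twistedReg (hω : IsTwoCocycle ω) (g : Γ) {k : Γ} {x : BL2 Γ}
    (hx : x ∈ Submodule.span ℂ {twistedReg ω k}) :
    star (twistedReg ω g) * x * twistedReg ω g ∈ Submodule.span ℂ {twistedReg ω (g⁻¹ * k * g)} :=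
  mul_mem_span_twistedReg hω (mul_mem_span_twistedReg hω
    (star_mem_span_twistedReg hω (Submodule.mem_span_singleton_self _)) hx)
    (Submodule.mem_span_singleton_self _)

end homogeneous

/-! ### The fixed point algebra as a closed span -/

section fixedPoints

variable {α : Coaction Γ π} {ω : Γ → Γ → Circle}

variable (α ω) in
/-- The products of homogeneous elements. -/
def homogeneousProducts : Set (BL2 (Γ × (J × Γ))) :=
  {R | ∃ g k, ∃ a ∈ spectralSubspace α g, ∃ x ∈ Submodule.span ℂ {twistedReg ω k},
    R = braidedProduct α ω a x}

variable (α ω) in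
/-- The products of homogeneous elements that are invariant under the diagonal coaction. -/
def invariantProducts : Set (BL2 (Γ × (J × Γ))) :=
  {R | ∃ g, ∃ a ∈ spectralSubspace α g, R = braidedProduct α ω a (twistedReg ω g⁻¹)}

/-- Each generator is approximated in both arguments, by spectral elements of `A` and by the
`λ^ω_k`. Allowing multiples of `λ^ω_k` in `homogeneousProducts` absorbs the phases, so that this set
is stable under products and adjoints. -/
theorem braidedTensor_subset (hπ : Function.Injective π) (hω : IsTwoCocycle ω) :
    (braidedTensor α ω : Set (BL2 (Γ × (J × Γ)))) ⊆
      closure (Submodule.span ℂ (homogeneousProducts α ω) : Set (BL2 (Γ × (J × Γ)))) := by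
  set Q := (NonUnitalStarAlgebra.adjoin ℂ (homogeneousProducts α ω)).topologicalClosure with hQ
  have hQc : IsClosed (Q.toSubmodule : Set (BL2 (Γ × (J × Γ)))) := isClosed_closure
  have hle : braidedTensor α ω ≤ Q := by
    refine NonUnitalStarSubalgebra.topologicalClosure_minimal _
      (NonUnitalStarAlgebra.adjoin_le ?_) hQc
    rintro _ ⟨a, x, hx, rfl⟩
    change braidedProduct α ω a x ∈ Q.toSubmodule
    refine map_mem_of_mem_closure_span (φ := fun a => braidedProduct α ω a x)
      ⟨fun a b => ?_, fun c a => ?_⟩ ?_ hQc (fun a ha => ?_)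
      (mem_closure_span_spectralSubspace hπ α a)
    · simp only [braidedProduct, map_add α.toHom, starHom_add, add_mul]
    · simp only [braidedProduct, map_smul α.toHom, starHom_smul, smul_mul_assoc]
    · exact ((continuous_starHom (leg12 Γ J)).comp (continuous_representation α.toHom)).mul
        continuous_const
    obtain ⟨g, ha⟩ := Set.mem_iUnion.1 ha
    refine map_mem_of_mem_closure_span (φ := fun x => braidedProduct α ω a x)
      ⟨fun x y => ?_, fun c x => ?_⟩ ?_ hQc ?_ (twistedGroupAlgebra_subset hω hx)
    · simp only [braidedProduct, starHom_add, mul_add]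
    · exact braidedProduct_smul α ω a c x
    · exact continuous_const.mul ((continuous_starHom (leg13 Γ J)).comp
        (continuous_starHom (adCoaction ω)))
    · rintro _ ⟨k, rfl⟩
      exact NonUnitalStarSubalgebra.le_topologicalClosure _ (NonUnitalStarAlgebra.subset_adjoin ℂ _
        ⟨g, k, a, ha, _, Submodule.mem_span_singleton_self _, rfl⟩)
  refine Set.Subset.trans hle (closure_mono fun x hx => adjoin_le_span ?_ ?_ hx)
  · rintro _ ⟨g, k, a, ha, x, hx, rfl⟩ _ ⟨h, l, b, hb, y, hy, rfl⟩
    exact ⟨_, _, _, mul_mem_spectralSubspace ha hb, _,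
      mul_mem_span_twistedReg hω (conj_mem_span_twistedReg hω h hx) hy,
      braidedProduct_mul hω hb hx⟩
  · rintro _ ⟨g, k, a, ha, x, hx, rfl⟩
    exact ⟨_, _, _, star_mem_spectralSubspace ha, _,
      conj_mem_span_twistedReg hω _ (star_mem_span_twistedReg hω hx),
      star_braidedProduct hω ha hx⟩

theorem isTwoCocycle_conjCocycle (hω : IsTwoCocycle ω) : IsTwoCocycle (conjCocycle ω) where
  cocycle g h k := by
    simp only [conjCocycle, ← mul_inv, hω.cocycle]
  right_one g := by simp [conjCocycle, hω.right_one]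
  left_one g := by simp [conjCocycle, hω.left_one]

/-- The fixed point algebra is spanned by the invariant products of homogeneous elements. -/
theorem deformedAlgebra_eq_closure (hπ : Function.Injective π) (hω : IsTwoCocycle ω) :
    (deformedAlgebra α ω : Set (BL2 (Γ × (J × Γ)))) =
      closure (Submodule.span ℂ (invariantProducts α (conjCocycle ω)) :
        Set (BL2 (Γ × (J × Γ)))) := by
  have hω' := isTwoCocycle_conjCocycle hω
  refine Set.Subset.antisymm (fun R hR => ?_) (closure_minimal ?_ ?_)
  · have hfix : diagonalCoaction Γ J R = amp Γ R := hR.2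
    -- A fixed point equals its own coefficient at the identity. It therefore suffices to compute
    -- this coefficient on homogeneous products, where it keeps degree one and kills the rest.
    have hcompress : compress (1 : Γ) (diagonalCoaction Γ J R) = R := by
      rw [hfix, compress_one_amp]
    rw [← hcompress]
    refine map_mem_of_mem_closure_span (φ := fun R => compress (1 : Γ) (diagonalCoaction Γ J R))
      (K := (Submodule.span ℂ (invariantProducts α (conjCocycle ω))).topologicalClosure)
      ⟨fun a b => ?_, fun c a => ?_⟩ ?_ isClosed_closure ?_ (braidedTensor_subset hπ hω' hR.1)
    · rw [starHom_add, compress_add]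
    · rw [starHom_smul, compress_smul]
    · exact (continuous_compress 1).comp (continuous_starHom (diagonalCoaction Γ J))
    · rintro _ ⟨g, k, a, ha, x, hx, rfl⟩
      simp only [diagonalCoaction_braidedProduct ha hx]
      by_cases hgk : g * k = 1
      · rw [hgk, compress_opTensor_self]
        -- Degree one forces `k = g⁻¹`; the remaining scalar is absorbed by the span.
        obtain rfl := eq_inv_of_mul_eq_one_right hgk
        obtain ⟨c, rfl⟩ := Submodule.mem_span_singleton.1 hx
        refine Submodule.le_topologicalClosure _ ?_
        rw [braidedProduct_smul]
        exact Submodule.smul_mem _ c (Submodule.subset_span ⟨g, a, ha, rfl⟩)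
      · rw [compress_opTensor_of_ne hgk]
        exact zero_mem _
  · change Submodule.span ℂ _ ≤ (deformedAlgebra α ω).toSubmodule
    refine Submodule.span_le.2 ?_
    rintro _ ⟨g, a, ha, rfl⟩
    refine ⟨NonUnitalStarSubalgebra.le_topologicalClosure _
      (NonUnitalStarAlgebra.subset_adjoin ℂ _ ⟨a, _, twistedReg_mem _ _, rfl⟩), ?_⟩
    change diagonalCoaction Γ J _ = amp Γ _
    rw [diagonalCoaction_braidedProduct ha (Submodule.mem_span_singleton_self _),
      mul_inv_cancel, opTensor_twistedReg_trivial_one]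
  · exact isClosed_closure.inter (isClosed_eq (continuous_starHom (diagonalCoaction Γ J))
      (continuous_starHom (amp Γ)))

/-- An injective homomorphism that maps a total set into the span of the invariant products, and
whose range contains these products, has the fixed point algebra as its range. -/
theorem range_eq_deformedAlgebra {B : Type*} [NonUnitalCStarAlgebra B]
    (hπ : Function.Injective π) (hω : IsTwoCocycle ω) (Ψ : B →⋆ₙₐ[ℂ] BL2 (Γ × (J × Γ)))
    (hΨ : Function.Injective Ψ) (S : Set B) (hS : ∀ b, b ∈ closure (Submodule.span ℂ S : Set B))
    (h₁ : ∀ b ∈ S, Ψ b ∈ Submodule.span ℂ (invariantProducts α (conjCocycle ω)))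
    (h₂ : ∀ g, ∀ a ∈ spectralSubspace α g, ∃ b, Ψ b = braidedProduct α (conjCocycle ω) a
      (twistedReg (conjCocycle ω) g⁻¹)) :
    NonUnitalStarAlgHom.range Ψ = deformedAlgebra α ω := by
  apply SetLike.coe_injective
  rw [deformedAlgebra_eq_closure hπ hω]
  refine Set.Subset.antisymm ?_ (closure_minimal ?_ ?_)
  · rintro _ ⟨b, rfl⟩
    refine map_mem_of_mem_closure_span (φ := Ψ)
      (K := (Submodule.span ℂ (invariantProducts α (conjCocycle ω))).topologicalClosure)
      (isLinearMap_representation Ψ) (continuous_representation Ψ) isClosed_closure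
      (fun s hs => Submodule.le_topologicalClosure _ (h₁ s hs)) (hS b)
  · change Submodule.span ℂ _ ≤ (NonUnitalStarAlgHom.range Ψ).toSubmodule
    refine Submodule.span_le.2 ?_
    rintro _ ⟨g, a, ha, rfl⟩
    exact h₂ g a ha
  -- Injectivity makes the homomorphism isometric, so its range is closed and contains the closure
  -- of the span.
  · rw [NonUnitalStarAlgHom.coe_range]
    exact (NonUnitalStarAlgHom.isometry Ψ hΨ).isClosedEmbedding.isClosed_range

end fixedPoints

/-! ### Conjugation by the regular unitary -/

variable (J) in
/-- The leg `W^ω_{13}` of the regular representation, `δ_h ⊗ ξ ⊗ δ_k ↦ ω(h, k) δ_h ⊗ ξ ⊗ δ_{hk}`. -/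
def regUnitary13 (ω : Γ → Γ → Circle) : L2 (Γ × (J × Γ)) ≃ₗᵢ[ℂ] L2 (Γ × (J × Γ)) :=
  monomial
    { toFun := fun p => (p.1, p.2.1, p.1 * p.2.2)
      invFun := fun p => (p.1, p.2.1, p.1⁻¹ * p.2.2)
      left_inv := fun p => by simp
      right_inv := fun p => by simp } fun p => ω p.1 p.2.2

theorem regUnitary13_apply (ω : Γ → Γ → Circle) (f : L2 (Γ × (J × Γ))) (h : Γ) (j : J) (m : Γ) :
    regUnitary13 J ω f (h, j, m) = ω h (h⁻¹ * m) * f (h, j, h⁻¹ * m) := rfl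

theorem regUnitary13_symm_apply (ω : Γ → Γ → Circle) (f : L2 (Γ × (J × Γ))) (h : Γ) (j : J)
    (m : Γ) :
    (regUnitary13 J ω).symm f (h, j, m) = (ω h m : ℂ)⁻¹ * f (h, j, h * m) := rfl

variable (J) in
/-- `T ↦ (W^ω_{13})* T_{12} W^ω_{13}`. -/
def twistedLeg12 (ω : Γ → Γ → Circle) : BL2 (Γ × J) →⋆ₐ[ℂ] BL2 (Γ × (J × Γ)) :=
  (conj (regUnitary13 J ω).symm).comp (leg12 Γ J)

theorem conj_injective (U : L2 X ≃ₗᵢ[ℂ] L2 Y) : Function.Injective (conj U) :=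
  U.conjStarAlgEquiv.injective

theorem twistedLeg12_injective (ω : Γ → Γ → Circle) :
    Function.Injective (twistedLeg12 J ω) := by
  intro S T h
  exact amp_injective (conj_injective _ (conj_injective _ (conj_injective _ h)))

/-- Apart from `T` on the middle leg, conjugation turns `λ_g` into `δ_h ⊗ δ_m ↦ δ_{gh} ⊗
δ_{h⁻¹g⁻¹hm}`. The motion in the last leg is `Ad_{h⁻¹}(λ_{g⁻¹})` in the fibre over `h`. -/
theorem twistedLeg12_opTensor (g : Γ) (T : BL2 J) :
    twistedLeg12 J (trivialCocycle Γ) (opTensor (twistedReg (trivialCocycle Γ) g) T) =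
      leg12 Γ J (opTensor (twistedReg (trivialCocycle Γ) g) T) *
        leg13 Γ J (adCoaction (trivialCocycle Γ) (twistedReg (trivialCocycle Γ) g⁻¹)) := by
  ext f ⟨h, j, m⟩
  rw [mul_apply_eq_comp, leg12_opTensor_apply, twistedLeg12, StarAlgHom.comp_apply, conj_apply,
    regUnitary13_symm_apply, leg12_opTensor_apply]
  simp only [trivialCocycle, Circle.coe_one, inv_one, one_mul]
  refine congrArg (fun v => T v j) ?_
  ext j'
  simp [leg13_adCoaction_apply, regUnitary13_apply, trivialCocycle, mul_assoc]

/-- The flip puts `λ^ω_g` in the first leg, so its phase meets those of the regular unitary for the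
conjugate cocycle. Together they differ from the phases of the invariant product by a factor
independent of the basis vector. -/
theorem twistedLeg12_gradedCoaction {ω : Γ → Γ → Circle} (hω : IsTwoCocycle ω) (g : Γ) :
    twistedLeg12 Γ (conjCocycle ω)
        (reindex (Equiv.prodComm Γ Γ) (gradedCoaction (id : Γ → Γ) (twistedReg ω g))) =
      (ω g⁻¹ g : ℂ) • (leg12 Γ Γ (opTensor (twistedReg (trivialCocycle Γ) g)
          (twistedReg (trivialCocycle Γ) g)) *
        leg13 Γ Γ (adCoaction (conjCocycle ω) (twistedReg (conjCocycle ω) g⁻¹))) := by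
  ext f ⟨h, j, m⟩
  change _ = (ω g⁻¹ g : ℂ) * (leg12 Γ Γ (opTensor (twistedReg (trivialCocycle Γ) g)
          (twistedReg (trivialCocycle Γ) g)) *
        leg13 Γ Γ (adCoaction (conjCocycle ω) (twistedReg (conjCocycle ω) g⁻¹))) f (h, j, m)
  rw [mul_apply_eq_comp, leg12_opTensor_apply, twistedLeg12, StarAlgHom.comp_apply, conj_apply,
    regUnitary13_symm_apply]
  simp [leg12, leg13_adCoaction_apply, regUnitary13_apply, trivialCocycle, conjCocycle, mul_assoc]
  -- The two cocycle identities share the term `ω(g, g⁻¹hm)`; eliminating it leaves the required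
  -- relation between phases.
  have c₁ := hω.cocycle g (g⁻¹ * h) m
  have c₂ := hω.cocycle g⁻¹ g (g⁻¹ * h * m)
  rw [inv_mul_cancel, hω.left_one, mul_one, mul_assoc, mul_inv_cancel_left] at c₂
  rw [mul_inv_cancel_left, mul_assoc] at c₁
  have c : ω h m * ω g (g⁻¹ * h) = ω g⁻¹ g * ω (g⁻¹ * h) m * (ω g⁻¹ (h * m))⁻¹ := by
    rw [mul_comm, c₁, c₂]
    simp [mul_comm, mul_left_comm]
  have hc := congrArg (fun z : Circle => (z : ℂ)) c
  simp only [Circle.coe_mul, Circle.coe_inv] at hc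
  rw [← mul_assoc, hc]
  simp only [mul_assoc]

/-- The coefficient map `x ↦ compress g (δ(x))` fixes the spectral subspace and sends each `λ_k` to
`λ_g` or zero. By continuity it maps all of `C*_r(Γ)` into the line through `λ_g`, which is closed
because it is finite dimensional. -/
theorem mem_span_twistedReg_of_mem_spectralSubspace {g : Γ} {a : reducedGroupAlgebra Γ}
    (ha : a ∈ spectralSubspace (coproductCoaction Γ) g) :
    (a : BL2 Γ) ∈ Submodule.span ℂ {twistedReg (trivialCocycle Γ) g} := by
  have h : compress g (gradedCoaction (id : Γ → Γ) (a : BL2 Γ)) = a := by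
    have h' : gradedCoaction (id : Γ → Γ) (a : BL2 Γ) =
        opTensor (twistedReg (trivialCocycle Γ) g) (a : BL2 Γ) := ha
    rw [h', compress_opTensor_self]
  rw [← h]
  refine map_mem_of_mem_closure_span
    (φ := fun x : BL2 Γ => compress g (gradedCoaction (id : Γ → Γ) x))
    ⟨fun x y => ?_, fun c x => ?_⟩ ?_ (Submodule.closed_of_finiteDimensional _) ?_
    (twistedGroupAlgebra_subset isTwoCocycle_trivialCocycle a.2)
  · rw [starHom_add, compress_add]
  · rw [starHom_smul, compress_smul]
  · exact (continuous_compress g).comp (continuous_gradedCoaction _)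
  · rintro _ ⟨k, rfl⟩
    simp only [gradedCoaction_twistedReg]
    by_cases hk : k = g
    · rw [hk, compress_opTensor_self]
      exact Submodule.mem_span_singleton_self _
    · rw [compress_opTensor_of_ne hk]
      exact zero_mem _

/-! ### The two isomorphisms -/

theorem conjCocycle_trivialCocycle (G : Type*) :
    conjCocycle (trivialCocycle G) = trivialCocycle G := by
  ext g h
  simp [conjCocycle, trivialCocycle]

/-- Deforming by the trivial cocycle does not change the algebra. -/
theorem exists_range_eq_deformedAlgebra_trivial (hπ : Function.Injective π) (α : Coaction Γ π) :
    ∃ Ψ : A →⋆ₙₐ[ℂ] BL2 (Γ × (J × Γ)), Function.Injective Ψ ∧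
      NonUnitalStarAlgHom.range Ψ = deformedAlgebra α (trivialCocycle Γ) := by
  let Ψ : A →⋆ₙₐ[ℂ] BL2 (Γ × (J × Γ)) :=
    NonUnitalStarAlgHom.comp
      (twistedLeg12 J (trivialCocycle Γ) : BL2 (Γ × J) →⋆ₙₐ[ℂ] BL2 (Γ × (J × Γ))) α.toHom
  have hΨ : Function.Injective Ψ := (twistedLeg12_injective _).comp α.injective
  have key {g : Γ} {a : A} (ha : a ∈ spectralSubspace α g) :
      Ψ a = braidedProduct α (conjCocycle (trivialCocycle Γ)) a
        (twistedReg (conjCocycle (trivialCocycle Γ)) g⁻¹) := by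
    change twistedLeg12 J (trivialCocycle Γ) (α.toHom a) = _
    rw [braidedProduct, conjCocycle_trivialCocycle, ha, twistedLeg12_opTensor]
  refine ⟨Ψ, hΨ, range_eq_deformedAlgebra hπ isTwoCocycle_trivialCocycle Ψ hΨ _
    (mem_closure_span_spectralSubspace hπ α) (fun a ha => ?_) fun g a ha => ⟨a, key ha⟩⟩
  obtain ⟨g, ha⟩ := Set.mem_iUnion.1 ha
  exact Submodule.subset_span ⟨g, a, ha, key ha⟩

/-- Deforming `C*_r(Γ)` gives the twisted group algebra. -/
theorem exists_range_eq_deformedAlgebra_coproduct {ω : Γ → Γ → Circle} (hω : IsTwoCocycle ω) :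
    ∃ Ψ : twistedGroupAlgebra ω →⋆ₙₐ[ℂ] BL2 (Γ × (Γ × Γ)), Function.Injective Ψ ∧
      NonUnitalStarAlgHom.range Ψ = deformedAlgebra (coproductCoaction Γ) ω := by
  -- On `λ^ω_g` this is `λ^ω_g ⊗ λ_g` in the first two legs, conjugated by the regular unitary of
  -- the conjugate cocycle in legs 1 and 3.
  let Θ : BL2 Γ →⋆ₐ[ℂ] BL2 (Γ × (Γ × Γ)) :=
    (twistedLeg12 Γ (conjCocycle ω)).comp
      ((reindex (Equiv.prodComm Γ Γ)).comp (gradedCoaction (id : Γ → Γ)))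
  have hΘ : Function.Injective Θ := fun S T h =>
    gradedCoaction_injective _ (conj_injective _ (twistedLeg12_injective _ h))
  let Ψ : twistedGroupAlgebra ω →⋆ₙₐ[ℂ] BL2 (Γ × (Γ × Γ)) :=
    NonUnitalStarAlgHom.comp (Θ : BL2 Γ →⋆ₙₐ[ℂ] BL2 (Γ × (Γ × Γ)))
      (NonUnitalStarSubalgebraClass.subtype (twistedGroupAlgebra ω))
  have hΨ : Function.Injective Ψ := hΘ.comp Subtype.val_injective
  let l (g : Γ) : reducedGroupAlgebra Γ := ⟨twistedReg (trivialCocycle Γ) g, twistedReg_mem _ g⟩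
  have hl (g : Γ) : l g ∈ spectralSubspace (coproductCoaction Γ) g :=
    gradedCoaction_twistedReg (trivialCocycle Γ) g
  have key (g : Γ) : Θ (twistedReg ω g) = (ω g⁻¹ g : ℂ) •
      braidedProduct (coproductCoaction Γ) (conjCocycle ω) (l g)
        (twistedReg (conjCocycle ω) g⁻¹) := by
    rw [braidedProduct, hl g]
    exact twistedLeg12_gradedCoaction hω g
  refine ⟨Ψ, hΨ, range_eq_deformedAlgebra Subtype.val_injective hω Ψ hΨ
    {b | (b : BL2 Γ) ∈ Set.range (twistedReg ω)} (fun b => mem_closure_span_coe ?_ b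
      (twistedGroupAlgebra_subset hω b.2)) ?_ fun g a ha => ?_⟩
  · rintro _ ⟨g, rfl⟩
    exact twistedReg_mem ω g
  · rintro ⟨_, _⟩ ⟨g, rfl⟩
    change Θ (twistedReg ω g) ∈ _
    rw [key]
    exact Submodule.smul_mem _ _ (Submodule.subset_span ⟨g, l g, hl g, rfl⟩)
  · obtain ⟨c, hc⟩ := Submodule.mem_span_singleton.1
      (mem_span_twistedReg_of_mem_spectralSubspace ha)
    obtain rfl : c • l g = a := Subtype.ext hc
    -- The spectral element is `c λ_g`, and the inverse factor cancels the phase `ω(g⁻¹, g)`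
    -- produced by `Θ`.
    refine ⟨(c * (ω g⁻¹ g : ℂ)⁻¹) • ⟨twistedReg ω g, twistedReg_mem ω g⟩, ?_⟩
    change Θ ((c * (ω g⁻¹ g : ℂ)⁻¹) • twistedReg ω g) = _
    rw [starHom_smul, key, smul_smul, mul_assoc, inv_mul_cancel₀ (Circle.coe_ne_zero _), mul_one,
      braidedProduct, braidedProduct, map_smul, starHom_smul, smul_mul_assoc]

theorem nonempty_equiv_of_range_eq {B : Type*} [NonUnitalCStarAlgebra B]
    {N : NonUnitalStarSubalgebra ℂ (BL2 X)}
    (h : ∃ Ψ : B →⋆ₙₐ[ℂ] BL2 X, Function.Injective Ψ ∧ NonUnitalStarAlgHom.range Ψ = N) :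
    Nonempty (N ≃⋆ₐ[ℂ] B) := by
  obtain ⟨Ψ, hΨ, rfl⟩ := h
  exact ⟨(StarAlgEquiv.ofInjective' Ψ hΨ).symm⟩

end

end CocycleDeformation

theorem mainTheorem11 {Γ : Type u} [Group Γ] :
    (∀ (A : Type v) [NonUnitalCStarAlgebra A] (J : Type w) (π : A →⋆ₙₐ[ℂ] BL2 J)
        (_ : Function.Injective π) (α : Coaction Γ π),
      Nonempty (deformedAlgebra α (trivialCocycle Γ) ≃⋆ₐ[ℂ] A)) ∧
    (∀ ω : Γ → Γ → Circle, IsTwoCocycle ω →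
      Nonempty (deformedAlgebra (coproductCoaction Γ) ω ≃⋆ₐ[ℂ] twistedGroupAlgebra ω)) := by
  refine ⟨fun A _ J π hπ α => nonempty_equiv_of_range_eq
    (exists_range_eq_deformedAlgebra_trivial hπ α), fun ω hω => ?_⟩
  -- Closedness gives the twisted group algebra its C*-algebra structure, which the comparison of
  -- ranges requires of the domain.
  have : IsClosed (twistedGroupAlgebra ω : Set (BL2 Γ)) := isClosed_closure
  exact nonempty_equiv_of_range_eq (exists_range_eq_deformedAlgebra_coproduct hω)
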